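/- Let $\mathrm{Ai}(x)=\frac1\pi\int_0^\infty\cos\left(\frac{z^3}{3}+xz\right)dz$ (improper integral, $x\in\mathbb R$) be the Airy function. Let $X_3$ be the pseudo-process started at $0$ whose signed measure gives the cylinder $\{a_j\le x(t_j)\le b_j,\ j=1,\dots,n\}$ (with $0=t_0<t_1<\dots<t_n$, $x_0=0$) the value $\int_{a_1}^{b_1}\cdots\int_{a_n}^{b_n}\prod_{j=1}^n u_3(x_j-x_{j-1},t_j-t_{j-1})\,dx_n\cdots dx_1$, where $$u_3(x,s)=\frac1{2\pi}\int_{-\infty}^{\infty}e^{-i\beta x-is\beta^3}\,d\beta=\frac1\pi\int_0^\infty\cos(\beta x+\beta^3 s)\,d\beta\qquad(x\in\mathbb R,\ s>0)$$ (improper integrals) is the fundamental solution of $\partial_s u=-\partial_x^3u$. Let $S_{1/3}(t)$, $t>0$, be a positively skewed stable process of order $1/3$, i.e. $\mathbb E e^{i\beta S_{1/3}(t)}=\exp\left(-t|\beta|^{1/3}e^{-i\frac{\pi}{6}\operatorname{sgn}\beta}\right)$ for $\beta\in\mathbb R$, independent of $X_3$; thus the law of $X_3(S_{1/3}(t))$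 is $[a,b]\mapsto\mathbb E\left[\int_a^b u_3(x,s)\,dx\Big|_{s=S_{1/3}(t)}\right]$. Then: 1. For $x\in\mathbb R$, $s>0$ the integrals defining $u_3(x,s)$ converge and $u_3(x,s)=\frac{1}{\sqrt[3]{3s}}\mathrm{Ai}\left(\frac{x}{\sqrt[3]{3s}}\right)$. 2. For every $t>0$ the stable law of order $1/3$ above exists and is unique: it is the probability measure on $(0,\infty)$ with the nonnegative density $s\mapsto\frac ts\frac1{\sqrt[3]{3s}}\mathrm{Ai}\left(\frac t{\sqrt[3]{3s}}\right)$. Moreover, for $s,t>0$, $$\frac1{2\pi}\int_{-\infty}^\infty e^{-i\beta s}\exp\left(-t|\beta|^{1/3}e^{-i\frac{\pi}{6}\operatorname{sgn}\beta}\right)d\beta=\frac ts\frac1{\sqrt[3]{3s}}\mathrm{Ai}\left(\frac t{\sqrt[3]{3s}}\right).$$ 3. For every $t>0$ the law of $X_3(S_{1/3}(t))$ is well defined on bounded intervals (the expectation above converges absolutely) and has the density $$p(x,t)=\int_0^\infty\frac1{\sqrt[3]{3s}}\mathrm{Ai}\left(\frac x{\sqrt[3]{3s}}\right)\frac ts\frac1{\sqrt[3]{3s}}\mathrm{Ai}\left(\frac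 t{\sqrt[3]{3s}}\right)ds,\qquad x\in\mathbb R,$$ where the integral converges absolutely. 4. For $x\in\mathbb R$, $t>0$, $$p(x,t)=\frac1\pi\,\frac{\frac{\sqrt3}{2}t}{\left(x+\frac t2\right)^2+\frac{3t^2}{4}}=\frac{\sqrt3}{2\pi}\,\frac{t}{x^2+xt+t^2},$$ and, when $x\neq t$, also $p(x,t)=\frac{\sqrt3\,t}{2\pi}\,\frac{x-t}{x^3-t^3}$. 5. $p$ is $C^\infty$ on $\mathbb R\times(0,\infty)$ and solves there the third-order Laplace equation $\frac{\partial^3p}{\partial t^3}+\frac{\partial^3p}{\partial x^3}=0$. -/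

import Mathlib

open Real MeasureTheory Filter Topology

noncomputable section

/-- The Airy function `Ai` on the real line, as the improper (conditionally convergent) integral
`(1/π) ∫₀^∞ cos (z³/3 + x z) dz`. -/
def airyAi (x : ℝ) : ℝ :=
  limUnder atTop fun R : ℝ => (1 / π) * ∫ z in (0 : ℝ)..R, Real.cos (z ^ 3 / 3 + x * z)

/-- The fundamental solution `u₃(x, s) = (1/π) ∫₀^∞ cos (β x + β³ s) dβ` (improper integral) of the
third-order heat-type equation `∂u/∂s = - ∂³u/∂x³`. -/
def heatKernel3 (x s : ℝ) : ℝ :=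
  limUnder atTop fun R : ℝ => (1 / π) * ∫ β in (0 : ℝ)..R, Real.cos (β * x + β ^ 3 * s)

/-- The sign-varying measure of the pseudo-process `X₃`, on cylinders of paths that are at `x₀` at
time `t₀`: the list `[(t₁, a₁, b₁), …, (tₙ, aₙ, bₙ)]` with `t₀ < t₁ < … < tₙ` stands for the
cylinder `{a_j ≤ x(t_j) ≤ b_j, j = 1, …, n}`, whose measure is the iterated integral of
`∏ u₃(x_j - x_{j-1}, t_j - t_{j-1})`. -/
def pseudoCylinder3 : List (ℝ × ℝ × ℝ) → ℝ → ℝ → ℝ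
  | [], _, _ => 1
  | (t₁, a, b) :: l, t₀, x₀ =>
      ∫ x in a..b, heatKernel3 (x - x₀) (t₁ - t₀) * pseudoCylinder3 l t₁ x

/-- The signed measure of the event `a ≤ X₃(s) ≤ b`, where `X₃` starts at `0` at time `0`. -/
def pseudoMarginal3 (s a b : ℝ) : ℝ := pseudoCylinder3 [(s, a, b)] 0 0

/-- The characteristic function `exp (- t |β|^α e^{- i (π γ / 2) sgn β})` of `S_α(t)`. -/
def stableCharFun (α γ t β : ℝ) : ℂ :=
  Complex.exp (-((t * |β| ^ α : ℝ) : ℂ) *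
    Complex.exp (-Complex.I * ((π * γ / 2 * Real.sign β : ℝ) : ℂ)))

/-- `ν` is the stable law of order `α` with parameter `γ` at time `t`; the value `γ = α` is the
positively skewed case. -/
def IsStableLaw (α γ t : ℝ) (ν : Measure ℝ) : Prop :=
  IsProbabilityMeasure ν ∧ ∀ β : ℝ, charFun ν β = stableCharFun α γ t β

/-- The stable density `p_α(x; γ, t) = (1/2π) ∫ e^{-iβx} E e^{iβ S_α(t)} dβ`. -/
def stableDensity (α γ x t : ℝ) : ℂ :=
  (1 / (2 * π) : ℂ) *
    ∫ β : ℝ, Complex.exp (-Complex.I * ((β * x : ℝ) : ℂ)) * stableCharFun α γ t β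

/-- `S` is a (positively skewed) stable process of order `α`, as far as its one-dimensional
distributions go: these are all that the law of `X₃(S(t))` depends on. -/
def HasStableMarginals {Ω : Type*} [MeasurableSpace Ω] (α : ℝ) (P : Measure Ω)
    (S : ℝ → Ω → ℝ) : Prop :=
  ∀ t : ℝ, 0 < t → AEMeasurable (S t) P ∧ IsStableLaw α α t (P.map (S t))

/-- The law of `X₃(S(t))` with `X₃` and `S` independent, on the interval `[a, b]`: the measure of
`{a ≤ X₃(s) ≤ b}`, averaged over `s = S(t)`. -/
def composedLaw3 {Ω : Type*} [MeasurableSpace Ω] (P : Measure Ω) (S : ℝ → Ω → ℝ)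
    (t a b : ℝ) : ℝ :=
  ∫ ω, pseudoMarginal3 (S t ω) a b ∂P

/-- `(3s)^{-1/3} Ai (x / (3s)^{1/3})`. -/
def scaledAiry (x s : ℝ) : ℝ :=
  1 / (3 * s) ^ (1 / 3 : ℝ) * airyAi (x / (3 * s) ^ (1 / 3 : ℝ))

/-- `(t/s) (3s)^{-1/3} Ai (t / (3s)^{1/3})`. -/
def airyStableDensity (s t : ℝ) : ℝ := t / s * scaledAiry t s

/-- The measure on `(0, ∞)` with density `s ↦ (t/s) (3s)^{-1/3} Ai (t / (3s)^{1/3})`. -/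
def airyStableMeasure (t : ℝ) : Measure ℝ :=
  (volume.restrict (Set.Ioi 0)).withDensity fun s => ENNReal.ofReal (airyStableDensity s t)

/-- `∫₀^∞ (3s)^{-1/3} Ai (x / (3s)^{1/3}) (t/s) (3s)^{-1/3} Ai (t / (3s)^{1/3}) ds`. -/
def airyKernelIntegral (x t : ℝ) : ℝ :=
  ∫ s in Set.Ioi (0 : ℝ), scaledAiry x s * airyStableDensity s t

end

open Complex (I)

/-! Every oscillatory integral here is an integral of `exp (s q³ - t q)` along a ray. The integrand
is entire, so such integrals are differences of one primitive, `cubicPrimitive`, and turning a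
contour means showing that the primitive takes asymptotically equal values at two far points. On
vertical lines and on the ray of angle π/3 the Airy integrals converge absolutely. This gives the
Airy equation, decay at every exponential rate, and the product Ai(0) Ai'(0) = -1/(2π√3) that fixes
the constant in the closed form.

The substitution β = r³ turns Fourier inversion of the stable characteristic function into an
integral along the ray of angle π/6, on which q³ is imaginary. After an integration by parts this
ray turns to the imaginary axis when s > 0, giving the Airy density, and to the real axis when s <
0, giving zero (`stableDensity_third_of_pos`, `stableDensity_third_of_neg`). The resulting function
is integrable, so the inversion theorem identifies its transform
(`integral_exp_mul_airyStableDensity`), and `airyAi_nonneg` makes it the density of a measure.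

With w = (3s)^(-1/3) the kernel integral becomes 3t ∫ w Ai(xw) Ai(tw) dw. By the Airy equation its
integrand has an explicit primitive (`integral_airyProduct_of_ne`, `integral_airyProduct_self`), and
only the boundary term at w = 0 survives. Fubini transfers this to the law of the composition. -/

/-! ### Contour shifts for exp(s q³ - t q). -/

theorem exists_entire_primitive {f : ℂ → ℂ} (hf : Differentiable ℂ f) :
    ∃ P : ℂ → ℂ, P 0 = 0 ∧ ∀ q, HasDerivAt P (f q) q := by
  obtain ⟨P, hP⟩ := hf.isExactOn_univ
  exact ⟨fun q => P q - P 0, sub_self _, fun q => (hP q trivial).sub_const _⟩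

/-- The entire function `q ↦ exp (s q³ - t q)`. -/
noncomputable def cubicExp (s t : ℝ) (q : ℂ) : ℂ := Complex.exp (s * q ^ 3 - t * q)

theorem differentiable_cubicExp (s t : ℝ) : Differentiable ℂ (cubicExp s t) := by
  unfold cubicExp; fun_prop

@[fun_prop]
theorem continuous_cubicExp (s t : ℝ) : Continuous (cubicExp s t) :=
  (differentiable_cubicExp s t).continuous

/-- The primitive of `cubicExp s t` that vanishes at `0`. -/
noncomputable def cubicPrimitive (s t : ℝ) : ℂ → ℂ :=
  (exists_entire_primitive (differentiable_cubicExp s t)).choose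

theorem cubicPrimitive_zero (s t : ℝ) : cubicPrimitive s t 0 = 0 :=
  (exists_entire_primitive (differentiable_cubicExp s t)).choose_spec.1

theorem hasDerivAt_cubicPrimitive (s t : ℝ) (q : ℂ) :
    HasDerivAt (cubicPrimitive s t) (cubicExp s t q) q :=
  (exists_entire_primitive (differentiable_cubicExp s t)).choose_spec.2 q

theorem norm_cubicExp (s t : ℝ) (q : ℂ) :
    ‖cubicExp s t q‖ = Real.exp (s * (q.re ^ 3 - 3 * q.re * q.im ^ 2) - t * q.re) := by
  rw [cubicExp, Complex.norm_exp]
  congr 1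
  simp only [pow_succ, pow_zero, one_mul, Complex.sub_re, Complex.mul_re, Complex.ofReal_re,
    Complex.mul_im, Complex.ofReal_im]
  ring

theorem hasDerivAt_line (a ζ : ℂ) (r : ℝ) : HasDerivAt (fun r : ℝ => a + ζ * r) ζ r := by
  simpa using ((Complex.ofRealCLM.hasDerivAt (x := r)).const_mul ζ).const_add a

/-- Stands in for Cauchy's theorem: contours with common endpoints give the same difference of
values of the primitive. -/
theorem integral_cubicExp_line (s t : ℝ) (a ζ : ℂ) (r₁ r₂ : ℝ) :
    ∫ r in r₁..r₂, cubicExp s t (a + ζ * r) * ζ =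
      cubicPrimitive s t (a + ζ * r₂) - cubicPrimitive s t (a + ζ * r₁) := by
  refine intervalIntegral.integral_eq_sub_of_hasDerivAt
    (f := fun r : ℝ => cubicPrimitive s t (a + ζ * r)) (fun r _ => ?_) ?_
  · exact (hasDerivAt_cubicPrimitive s t _).comp_of_eq r (hasDerivAt_line a ζ r) rfl
  · exact Continuous.intervalIntegrable (by fun_prop) _ _

theorem cubicPrimitive_ofReal_im (s t X : ℝ) : (cubicPrimitive s t X).im = 0 := by
  have h := integral_cubicExp_line s t 0 1 0 X
  have h2 : ∀ r : ℝ, cubicExp s t (0 + 1 * r) * 1 = (Real.exp (s * r ^ 3 - t * r) : ℝ) := by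
    intro r; simp [cubicExp]
  simp only [h2, intervalIntegral.integral_ofReal] at h
  simp only [zero_add, one_mul, Complex.ofReal_zero, cubicPrimitive_zero, sub_zero] at h
  rw [← h, Complex.ofReal_im]

/-- On the imaginary axis the exponent is purely imaginary, and dq = i dy moves the cosine into the
imaginary part. -/
theorem cubicPrimitive_I_mul_im (s t Y : ℝ) :
    (cubicPrimitive s t (I * Y)).im = ∫ y in (0 : ℝ)..Y, Real.cos (t * y + s * y ^ 3) := by
  have h := integral_cubicExp_line s t 0 I 0 Y
  simp only [zero_add, Complex.ofReal_zero, mul_zero, cubicPrimitive_zero, sub_zero] at h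
  have h3 : IntervalIntegrable (fun r : ℝ => cubicExp s t (I * r) * I) volume 0 Y :=
    Continuous.intervalIntegrable (by fun_prop) _ _
  have h2 := Complex.imCLM.intervalIntegral_comp_comm h3
  rw [h] at h2
  simp only [Complex.imCLM_apply] at h2
  rw [← h2]
  refine intervalIntegral.integral_congr fun y _ => ?_
  have : (s : ℂ) * (I * y) ^ 3 - t * (I * y) = ((-(t * y + s * y ^ 3) : ℝ) : ℂ) * I := by
    push_cast; rw [mul_pow, Complex.I_pow_three]; ring
  simp only [cubicExp, this, Complex.mul_I_im, Complex.exp_ofReal_mul_I_re, Real.cos_neg]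

/-- At q = r + iy with r ≤ y one has Re q³ = r³ - 3ry² ≤ -2ry², so the integrand is at most
exp(-(2sy² + t) r). -/
theorem norm_cubicPrimitive_horizontal_le {s t ξ y : ℝ} (hs : 0 ≤ s) (hξ : 0 ≤ ξ) (hy : ξ ≤ y)
    (hc : 0 < 2 * s * y ^ 2 + t) :
    ‖cubicPrimitive s t (ξ + I * y) - cubicPrimitive s t (I * y)‖ ≤ 1 / (2 * s * y ^ 2 + t) := by
  have h := integral_cubicExp_line s t (I * y) 1 0 ξ
  simp only [one_mul, Complex.ofReal_zero, add_zero, mul_one] at h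
  rw [add_comm (ξ : ℂ), ← h]
  set c := 2 * s * y ^ 2 + t
  have h1 : ‖∫ r in (0 : ℝ)..ξ, cubicExp s t (I * y + r)‖ ≤ ∫ r in (0 : ℝ)..ξ, Real.exp (-c * r) := by
    refine intervalIntegral.norm_integral_le_of_norm_le hξ (ae_of_all _ fun r hr => ?_)
      (Continuous.intervalIntegrable (by fun_prop) _ _)
    rw [norm_cubicExp]
    simp only [Complex.add_re, Complex.mul_re, Complex.I_re, Complex.ofReal_re, Complex.I_im,
      Complex.ofReal_im, Complex.add_im, Complex.mul_im, Real.exp_le_exp]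
    have h0 : 0 ≤ r := hr.1.le
    have h5 : 0 ≤ s * (r * (y ^ 2 - r ^ 2)) := by
      refine mul_nonneg hs (mul_nonneg h0 ?_)
      nlinarith [hr.2]
    simp only [c]
    nlinarith
  refine h1.trans ?_
  have h6 : ∫ r in (0 : ℝ)..ξ, Real.exp (-c * r) = (1 - Real.exp (-c * ξ)) / c := by
    rw [intervalIntegral.integral_comp_mul_left (fun x => Real.exp x) (neg_ne_zero.2 hc.ne')]
    simp; field_simp; ring
  rw [h6]
  gcongr
  linarith [Real.exp_pos (-c * ξ)]

theorem tendsto_one_div_quadratic {s : ℝ} (hs : 0 < s) (t : ℝ) :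
    Tendsto (fun y : ℝ => 1 / (2 * s * y ^ 2 + t)) atTop (𝓝 0) ∧
      ∀ᶠ y : ℝ in atTop, 0 < 2 * s * y ^ 2 + t := by
  have h : Tendsto (fun y : ℝ => 2 * s * y ^ 2 + t) atTop atTop :=
    tendsto_atTop_add_const_right _ _
      ((tendsto_pow_atTop two_ne_zero).const_mul_atTop (by positivity))
  refine ⟨?_, h.eventually_gt_atTop 0⟩
  simp only [one_div]
  exact h.inv_tendsto_atTop

/-- Horizontal shifts by at most the height do not matter far up the imaginary axis. -/
theorem tendsto_cubicPrimitive_horizontal {s : ℝ} (hs : 0 < s) (t : ℝ) {ξ : ℝ → ℝ}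
    (hξ : ∀ᶠ y in atTop, 0 ≤ ξ y ∧ ξ y ≤ y) :
    Tendsto (fun y : ℝ => cubicPrimitive s t (ξ y + I * y) - cubicPrimitive s t (I * y))
      atTop (𝓝 0) := by
  refine squeeze_zero_norm' ?_ (tendsto_one_div_quadratic hs t).1
  filter_upwards [hξ, (tendsto_one_div_quadratic hs t).2] with y h1 h2
  exact norm_cubicPrimitive_horizontal_le hs.le h1.1 h1.2 h2

theorem tendsto_mul_exp_neg_mul {t : ℝ} (ht : 0 < t) :
    Tendsto (fun y : ℝ => y * Real.exp (-t * y)) atTop (𝓝 0) := by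
  have := Real.tendsto_pow_mul_exp_neg_atTop_nhds_zero 1
  have h2 := (this.comp (tendsto_id.const_mul_atTop ht)).const_mul (1 / t)
  simp only [mul_zero] at h2
  refine h2.congr fun y => ?_
  simp; field_simp

/-- The horizontal segment is cut at real part y. Beyond it Re q³ is still nonpositive, as r² ≤ 3y²,
but no longer very negative, so there the factor exp(-t r) ≤ exp(-t y) has to beat the length (√3 -
1) y. -/
theorem tendsto_cubicPrimitive_ray_pos {s t : ℝ} (hs : 0 < s) (ht : 0 < t) :
    Tendsto (fun y : ℝ => cubicPrimitive s t ((√3 * y : ℝ) + I * y) - cubicPrimitive s t (I * y))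
      atTop (𝓝 0) := by
  have h1 := tendsto_cubicPrimitive_horizontal hs t (ξ := fun y => y)
    (by filter_upwards [eventually_ge_atTop 0] with y hy using ⟨hy, le_rfl⟩)
  have h2 : Tendsto (fun y : ℝ => cubicPrimitive s t ((√3 * y : ℝ) + I * y) -
      cubicPrimitive s t (y + I * y)) atTop (𝓝 0) := by
    have h4 := (tendsto_mul_exp_neg_mul ht).const_mul (√3 - 1)
    rw [mul_zero] at h4
    refine squeeze_zero_norm' ?_ h4
    filter_upwards [eventually_ge_atTop 0] with y hy
    have h := integral_cubicExp_line s t (I * y) 1 y (√3 * y)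
    simp only [one_mul, mul_one] at h
    rw [add_comm _ (I * (y : ℂ)), add_comm (y : ℂ), ← h]
    have hsq : (1 : ℝ) ≤ √3 := by rw [Real.one_le_sqrt]; norm_num
    have hle : y ≤ √3 * y := by nlinarith
    have h5 : ∀ r ∈ Set.uIoc y (√3 * y), ‖cubicExp s t (I * y + r)‖ ≤ Real.exp (-t * y) := by
      intro r hr
      rw [Set.uIoc_of_le hle] at hr
      rw [norm_cubicExp]
      simp only [Complex.add_re, Complex.mul_re, Complex.I_re, Complex.ofReal_re, Complex.I_im,
        Complex.ofReal_im, Complex.add_im, Complex.mul_im, Real.exp_le_exp]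
      have h0 : 0 ≤ r := hy.trans hr.1.le
      have h7 : r ^ 2 ≤ 3 * y ^ 2 := by
        have := pow_le_pow_left₀ h0 hr.2 2
        rwa [mul_pow, Real.sq_sqrt (by norm_num)] at this
      have h5 : 0 ≤ s * (r * (3 * y ^ 2 - r ^ 2)) :=
        mul_nonneg hs.le (mul_nonneg h0 (by linarith))
      have := mul_le_mul_of_nonneg_left hr.1.le ht.le
      nlinarith
    refine (intervalIntegral.norm_integral_le_of_norm_le_const h5).trans (le_of_eq ?_)
    rw [abs_of_nonneg (by linarith)]
    ring
  simpa using h2.add h1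

/-- Below the ray of angle π/6 one has Re q³ ≥ 0, so s Re q³ ≤ 0 for s ≤ 0, and exp(-t Re q) alone
controls the vertical segment. -/
theorem tendsto_cubicPrimitive_ray_neg {s t : ℝ} (hs : s ≤ 0) (ht : 0 < t) :
    Tendsto (fun y : ℝ => cubicPrimitive s t ((√3 * y : ℝ) + I * y) -
      cubicPrimitive s t (√3 * y : ℝ)) atTop (𝓝 0) := by
  refine squeeze_zero_norm' ?_ (tendsto_mul_exp_neg_mul ht)
  filter_upwards [eventually_ge_atTop 0] with y hy
  have h := integral_cubicExp_line s t (√3 * y : ℝ) I 0 y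
  simp only [Complex.ofReal_zero, mul_zero, add_zero] at h
  rw [← h]
  have hsq : (1 : ℝ) ≤ √3 := by rw [Real.one_le_sqrt]; norm_num
  have hle : y ≤ √3 * y := by nlinarith
  have h5 : ∀ r ∈ Set.uIoc 0 y, ‖cubicExp s t ((√3 * y : ℝ) + I * r) * I‖ ≤ Real.exp (-t * y) := by
    intro r hr
    rw [Set.uIoc_of_le hy] at hr
    rw [norm_mul, Complex.norm_I, mul_one, norm_cubicExp]
    simp only [Complex.add_re, Complex.mul_re, Complex.I_re, Complex.ofReal_re, Complex.I_im,
      Complex.ofReal_im, Complex.add_im, Complex.mul_im, Real.exp_le_exp]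
    have h3 : (√3 * y) ^ 2 = 3 * y ^ 2 := by rw [mul_pow, Real.sq_sqrt (by norm_num)]
    set X := √3 * y
    have h7 : r ^ 2 ≤ y ^ 2 := pow_le_pow_left₀ hr.1.le hr.2 2
    have h5 : 0 ≤ -s * (X * (X ^ 2 - 3 * r ^ 2)) :=
      mul_nonneg (by linarith) (mul_nonneg (hy.trans hle) (by linarith))
    have := mul_le_mul_of_nonneg_left hle ht.le
    nlinarith
  refine (intervalIntegral.norm_integral_le_of_norm_le_const h5).trans (le_of_eq ?_)
  rw [abs_of_nonneg (by linarith)]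
  ring

/-! ### Airy integrals along rays and the Airy equation. -/

/-- The ray `k + ζ r`, `r ≥ 0`, is one on which `exp (q³ / 3)` decays like a Gaussian. -/
def IsAiryRay (k : ℝ) (ζ : ℂ) : Prop :=
  ‖ζ‖ = 1 ∧ ∃ C c : ℝ, 0 < c ∧ ∀ r : ℝ, 0 ≤ r →
    ‖cubicExp (1 / 3) 0 (k + ζ * r)‖ ≤ C * Real.exp (-c * r ^ 2)

theorem isAiryRay_vertical {k : ℝ} (hk : 0 < k) : IsAiryRay k I := by
  refine ⟨Complex.norm_I, Real.exp (k ^ 3 / 3), k, hk, fun r _ => ?_⟩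
  rw [norm_cubicExp, ← Real.exp_add, Real.exp_le_exp]
  simp
  apply le_of_eq
  ring

/-- The direction `exp (i π / 3)`. -/
noncomputable def sixthRoot : ℂ := ⟨1 / 2, √3 / 2⟩

theorem sixthRoot_re : sixthRoot.re = 1 / 2 := rfl

theorem sixthRoot_im : sixthRoot.im = √3 / 2 := rfl

theorem sqrt_three_sq : √3 ^ 2 = (3 : ℝ) := Real.sq_sqrt (by norm_num)

theorem sixthRoot_pow_two : sixthRoot ^ 2 = ⟨-1 / 2, √3 / 2⟩ := by
  have := sqrt_three_sq
  rw [pow_two]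
  apply Complex.ext <;> simp [sixthRoot] <;> linarith

theorem sixthRoot_pow_three : sixthRoot ^ 3 = -1 := by
  have := sqrt_three_sq
  rw [pow_succ, sixthRoot_pow_two]
  apply Complex.ext <;> simp [sixthRoot] <;> linarith

theorem norm_sixthRoot : ‖sixthRoot‖ = 1 := by
  have h : ‖sixthRoot‖ ^ 3 = 1 := by rw [← norm_pow, sixthRoot_pow_three]; simp
  exact (pow_eq_one_iff_of_nonneg (norm_nonneg _) (by norm_num)).1 h

theorem cubicExp_sixthRoot (r : ℝ) :
    cubicExp (1 / 3) 0 (sixthRoot * r) = (Real.exp (-r ^ 3 / 3) : ℝ) := by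
  simp only [cubicExp, mul_pow, sixthRoot_pow_three]
  push_cast
  congr 1
  ring

theorem isAiryRay_sixthRoot : IsAiryRay 0 sixthRoot := by
  refine ⟨norm_sixthRoot, Real.exp (1 / 3), 1 / 3, by norm_num, fun r hr => ?_⟩
  rw [Complex.ofReal_zero, zero_add, cubicExp_sixthRoot, Complex.norm_real,
    Real.norm_of_nonneg (Real.exp_pos _).le, ← Real.exp_add, Real.exp_le_exp]
  -- The claim is r² ≤ r³ + 1; the difference is r(r - 1)² + (r² - r + 1).
  nlinarith [mul_nonneg hr (sq_nonneg (r - 1)), sq_nonneg (r - 1), sq_nonneg r]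

/-- The integrand of `∫ qⁿ exp (q³ / 3 - x q) dq` along the ray `q = k + ζ r`. -/
noncomputable def airyIntegrand (k : ℝ) (ζ : ℂ) (n : ℕ) (x r : ℝ) : ℂ :=
  (k + ζ * r) ^ n * cubicExp (1 / 3) x (k + ζ * r) * ζ

/-- The integral `∫ qⁿ exp (q³ / 3 - x q) dq` along the ray `q = k + ζ r`. -/
noncomputable def airyMoment (k : ℝ) (ζ : ℂ) (n : ℕ) (x : ℝ) : ℂ :=
  ∫ r in Set.Ioi (0 : ℝ), airyIntegrand k ζ n x r

theorem continuous_airyIntegrand (k : ℝ) (ζ : ℂ) (n : ℕ) (x : ℝ) :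
    Continuous (airyIntegrand k ζ n x) := by
  unfold airyIntegrand; fun_prop

theorem norm_cubicExp_eq (s t : ℝ) (q : ℂ) :
    ‖cubicExp s t q‖ = ‖cubicExp s 0 q‖ * Real.exp (-t * q.re) := by
  rw [norm_cubicExp, norm_cubicExp, ← Real.exp_add]
  congr 1; ring

/-- The bound is uniform in |x| ≤ M so that it also dominates derivatives in x. From |q| ≤ |k| + r,
the power costs n! exp(|k| + r) and the factor exp(-x Re q) costs exp(M(|k| + r)); the Gaussian
absorbs both. -/
theorem exists_airyIntegrand_bound {k : ℝ} {ζ : ℂ} (h : IsAiryRay k ζ) (n : ℕ) (M : ℝ) :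
    ∃ g : ℝ → ℝ, IntegrableOn g (Set.Ioi 0) ∧
      ∀ r ∈ Set.Ioi (0 : ℝ), ∀ x : ℝ, |x| ≤ M → ‖airyIntegrand k ζ n x r‖ ≤ g r := by
  obtain ⟨hζ, C, c, hc, hb⟩ := h
  refine ⟨fun r => n.factorial * Real.exp (M * |k| + |k|) * C *
    Real.exp (-c * r ^ 2 + (M + 1) * r), ?_, fun r hr x hx => ?_⟩
  · refine Integrable.const_mul ?_ _
    have := (integrable_cexp_quadratic (b := c) (by simpa using hc) (M + 1) 0).norm
    refine (this.congr (ae_of_all _ fun r => ?_)).integrableOn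
    simp only [Complex.norm_exp]
    congr 1
    simp [pow_two]
  · have hr0 : 0 ≤ r := le_of_lt hr
    set q : ℂ := k + ζ * r with hq
    have hqn : ‖q‖ ≤ |k| + r := by
      refine (norm_add_le _ _).trans ?_
      rw [norm_mul, hζ, Complex.norm_real, Complex.norm_real, one_mul, Real.norm_eq_abs,
        Real.norm_of_nonneg hr0]
    have hM : 0 ≤ M := (abs_nonneg x).trans hx
    have h1 : ‖q‖ ^ n ≤ n.factorial * Real.exp (|k| + r) := by
      have := Real.pow_div_factorial_le_exp _ (norm_nonneg q) n
      rw [div_le_iff₀ (by positivity)] at this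
      rw [mul_comm]
      exact this.trans (by gcongr)
    have h2 : Real.exp (-x * q.re) ≤ Real.exp (M * (|k| + r)) := by
      rw [Real.exp_le_exp]
      calc -x * q.re ≤ |x| * |q.re| := by rw [← abs_mul, neg_mul]; exact neg_le_abs _
        _ ≤ M * (|k| + r) := by
          gcongr
          exact (Complex.abs_re_le_norm q).trans hqn
    have h3 := hb r hr0
    rw [airyIntegrand, ← hq, norm_mul, norm_mul, hζ, mul_one, norm_pow, norm_cubicExp_eq]
    rw [← hq] at h3
    calc ‖q‖ ^ n * (‖cubicExp (1 / 3) 0 q‖ * Real.exp (-x * q.re))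
        ≤ (n.factorial * Real.exp (|k| + r)) *
          ((C * Real.exp (-c * r ^ 2)) * Real.exp (M * (|k| + r))) := by
          refine mul_le_mul h1 (mul_le_mul h3 h2 (Real.exp_pos _).le ((norm_nonneg _).trans h3))
            (by positivity) (by positivity)
      _ = n.factorial * C * (Real.exp (|k| + r) * Real.exp (-c * r ^ 2) *
            Real.exp (M * (|k| + r))) := by ring
      _ = n.factorial * C * (Real.exp (M * |k| + |k|) * Real.exp (-c * r ^ 2 + (M + 1) * r)) := by
          rw [← Real.exp_add, ← Real.exp_add, ← Real.exp_add]
          congr 2; ring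
      _ = _ := by ring

theorem integrableOn_airyIntegrand {k : ℝ} {ζ : ℂ} (h : IsAiryRay k ζ) (n : ℕ) (x : ℝ) :
    IntegrableOn (airyIntegrand k ζ n x) (Set.Ioi 0) := by
  obtain ⟨g, hg, hb⟩ := exists_airyIntegrand_bound h n |x|
  refine Integrable.mono' hg (continuous_airyIntegrand k ζ n x).aestronglyMeasurable ?_
  filter_upwards [ae_restrict_mem measurableSet_Ioi] with r hr using hb r hr x le_rfl

theorem hasDerivAt_airyMoment {k : ℝ} {ζ : ℂ} (h : IsAiryRay k ζ) (n : ℕ) (x : ℝ) :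
    HasDerivAt (airyMoment k ζ n) (-airyMoment k ζ (n + 1) x) x := by
  obtain ⟨g, hg, hb⟩ := exists_airyIntegrand_bound h (n + 1) (|x| + 1)
  have := (hasDerivAt_integral_of_dominated_loc_of_deriv_le
    (μ := volume.restrict (Set.Ioi (0 : ℝ))) (F := airyIntegrand k ζ n)
    (F' := fun x r => -airyIntegrand k ζ (n + 1) x r) (bound := g) (x₀ := x)
    (Metric.ball_mem_nhds x one_pos)
    (Eventually.of_forall fun y => (continuous_airyIntegrand k ζ n y).aestronglyMeasurable)
    (integrableOn_airyIntegrand h n x)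
    (continuous_airyIntegrand k ζ (n + 1) x).neg.aestronglyMeasurable ?_ hg ?_).2
  · rwa [integral_neg] at this
  · filter_upwards [ae_restrict_mem measurableSet_Ioi] with r hr y hy
    rw [norm_neg]
    refine hb r hr y ?_
    rw [Metric.mem_ball, Real.dist_eq] at hy
    have := abs_sub_abs_le_abs_sub y x
    linarith
  · refine ae_of_all _ fun r y _ => ?_
    set q : ℂ := k + ζ * r with hq
    have h1 : HasDerivAt (fun y : ℝ => ((1 / 3 : ℝ) : ℂ) * q ^ 3 - y * q) (-q) y := by
      have := (((Complex.ofRealCLM.hasDerivAt (x := y)).mul_const q).const_sub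
        (((1 / 3 : ℝ) : ℂ) * q ^ 3))
      simpa using this
    have h2 := (h1.cexp.const_mul (q ^ n)).mul_const ζ
    simp only [airyIntegrand, cubicExp, ← hq]
    exact h2.congr_deriv (by ring)

/-- On a vertical line Re q = k is constant, so x enters the norm of the integrand only through
exp(-k x). -/
theorem norm_airyMoment_le (k : ℝ) (n : ℕ) :
    ∃ C : ℝ, 0 ≤ C ∧ ∀ x : ℝ, ‖airyMoment k I n x‖ ≤ C * Real.exp (-k * x) := by
  refine ⟨∫ r in Set.Ioi (0 : ℝ), ‖airyIntegrand k I n 0 r‖,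
    integral_nonneg fun r => norm_nonneg _, fun x => ?_⟩
  rw [← integral_mul_const]
  refine (norm_integral_le_integral_norm _).trans (le_of_eq ?_)
  congr 1
  ext r
  rw [airyIntegrand, airyIntegrand, norm_mul, norm_mul, norm_mul, norm_mul,
    norm_cubicExp_eq (1 / 3) x]
  simp only [Complex.add_re, Complex.ofReal_re, Complex.mul_re, Complex.I_re, zero_mul,
    Complex.I_im, Complex.ofReal_im, mul_zero, sub_zero, add_zero]
  rw [neg_mul_comm x k, mul_neg, mul_comm x k, neg_mul]
  ring

/-- Rays that end in the upper half of the sector where `exp (q³/3)` decays all yield the Airy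
integral. -/
theorem tendsto_intervalIntegral_airy_of_ray {k : ℝ} {ζ : ℂ} (h : IsAiryRay k ζ)
    (hk : 0 ≤ k) (hre : 0 ≤ ζ.re) (hlt : ζ.re < ζ.im) (x : ℝ) :
    Tendsto (fun R : ℝ => ∫ z in (0 : ℝ)..R, Real.cos (x * z + 1 / 3 * z ^ 3)) atTop
      (𝓝 (airyMoment k ζ 0 x).im) := by
  have him : 0 < ζ.im := hre.trans_lt hlt
  have h1 : Tendsto (fun y : ℝ => cubicPrimitive (1 / 3) x (k + ζ * (y / ζ.im : ℝ)) -
      cubicPrimitive (1 / 3) x k) atTop (𝓝 (airyMoment k ζ 0 x)) := by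
    have := intervalIntegral_tendsto_integral_Ioi 0 (integrableOn_airyIntegrand h 0 x)
      (tendsto_id.atTop_div_const him)
    refine this.congr fun y => ?_
    have h2 := integral_cubicExp_line (1 / 3) x k ζ 0 (y / ζ.im)
    simp only [Complex.ofReal_zero, mul_zero, add_zero] at h2
    rw [← h2]
    simp [airyIntegrand]
  -- The ray point at height y has real part k + (Re ζ / Im ζ) y, which is eventually at most y
  -- since Re ζ < Im ζ. The start k is real, so it does not contribute to the imaginary part.
  have h2 := tendsto_cubicPrimitive_horizontal (s := 1 / 3) (by norm_num) x
    (ξ := fun y => k + ζ.re * (y / ζ.im)) (by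
      have h3 : 0 < 1 - ζ.re / ζ.im := by
        rw [sub_pos, div_lt_one him]; exact hlt
      filter_upwards [eventually_ge_atTop 0, eventually_ge_atTop (k / (1 - ζ.re / ζ.im))]
        with y hy hy2
      refine ⟨by positivity, ?_⟩
      rw [div_le_iff₀ h3] at hy2
      have : ζ.re * (y / ζ.im) = y * (ζ.re / ζ.im) := by ring
      rw [this]
      linarith)
  have h3 := h1.sub h2
  rw [sub_zero] at h3
  have h4 := (Complex.continuous_im.tendsto _).comp h3
  refine h4.congr fun y => ?_
  have h5 : ((k + ζ.re * (y / ζ.im) : ℝ) : ℂ) + I * y = k + ζ * (y / ζ.im : ℝ) := by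
    apply Complex.ext
    · simp
    · simp; field_simp
  rw [← cubicPrimitive_I_mul_im]
  simp only [Function.comp_apply, h5, Complex.sub_im, cubicPrimitive_ofReal_im]
  ring

theorem tendsto_airyAi_of_ray {k : ℝ} {ζ : ℂ} (h : IsAiryRay k ζ)
    (hk : 0 ≤ k) (hre : 0 ≤ ζ.re) (hlt : ζ.re < ζ.im) (x : ℝ) :
    Tendsto (fun R : ℝ => (1 / π) * ∫ z in (0 : ℝ)..R, Real.cos (z ^ 3 / 3 + x * z)) atTop
      (𝓝 (1 / π * (airyMoment k ζ 0 x).im)) := by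
  refine ((tendsto_intervalIntegral_airy_of_ray h hk hre hlt x).const_mul (1 / π)).congr fun R => ?_
  congr 2
  ext z
  congr 1
  ring

theorem airyAi_eq_of_ray {k : ℝ} {ζ : ℂ} (h : IsAiryRay k ζ)
    (hk : 0 ≤ k) (hre : 0 ≤ ζ.re) (hlt : ζ.re < ζ.im) (x : ℝ) :
    airyAi x = 1 / π * (airyMoment k ζ 0 x).im :=
  (tendsto_airyAi_of_ray h hk hre hlt x).limUnder_eq

theorem airyAi_eq_vertical {k : ℝ} (hk : 0 < k) (x : ℝ) :
    airyAi x = 1 / π * (airyMoment k I 0 x).im :=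
  airyAi_eq_of_ray (isAiryRay_vertical hk) hk.le (by simp) (by simp) x

theorem tendsto_airyAi (x : ℝ) :
    Tendsto (fun R : ℝ => (1 / π) * ∫ z in (0 : ℝ)..R, Real.cos (z ^ 3 / 3 + x * z)) atTop
      (𝓝 (airyAi x)) := by
  rw [airyAi_eq_vertical one_pos]
  exact tendsto_airyAi_of_ray (isAiryRay_vertical one_pos) zero_le_one (by simp) (by simp) x

/-- The derivative of the Airy function. -/
noncomputable def airyAiPrime (x : ℝ) : ℝ := 1 / π * (-airyMoment 1 I 1 x).im

theorem hasDerivAt_const_mul_im {f : ℝ → ℂ} {f' : ℂ} {x : ℝ} (h : HasDerivAt f f' x) (c : ℝ) :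
    HasDerivAt (fun x => c * (f x).im) (c * f'.im) x := by
  exact HasDerivAt.const_mul c (Complex.imCLM.hasFDerivAt.comp_hasDerivAt x h)

theorem hasDerivAt_airyAi_of_ray {k : ℝ} {ζ : ℂ} (h : IsAiryRay k ζ)
    (hk : 0 ≤ k) (hre : 0 ≤ ζ.re) (hlt : ζ.re < ζ.im) (x : ℝ) :
    HasDerivAt airyAi (1 / π * (-airyMoment k ζ 1 x).im) x := by
  rw [funext (airyAi_eq_of_ray h hk hre hlt)]
  exact hasDerivAt_const_mul_im (hasDerivAt_airyMoment h 0 x) _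

theorem hasDerivAt_airyAi (x : ℝ) : HasDerivAt airyAi (airyAiPrime x) x :=
  hasDerivAt_airyAi_of_ray (isAiryRay_vertical one_pos) zero_le_one (by simp) (by simp) x

@[fun_prop]
theorem continuous_airyAi : Continuous airyAi :=
  continuous_iff_continuousAt.2 fun x => (hasDerivAt_airyAi x).continuousAt

/-- (q² - x) exp(q³/3 - xq) is an exact derivative. The boundary term vanishes at infinity and is
real at q = k, so it drops out of the imaginary part. -/
theorem airyMoment_two_im (k : ℝ) (hk : 0 < k) (x : ℝ) :
    (airyMoment k I 2 x).im = x * (airyMoment k I 0 x).im := by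
  have hray := isAiryRay_vertical hk
  have hint := (integrableOn_airyIntegrand hray 2 x).sub
    ((integrableOn_airyIntegrand hray 0 x).const_mul (x : ℂ))
  have h0 : Tendsto (fun r : ℝ => cubicExp (1 / 3) x (k + I * r)) atTop (𝓝 0) := by
    rw [tendsto_zero_iff_norm_tendsto_zero]
    have h1 : Tendsto (fun r : ℝ => -k * r ^ 2 + (1 / 3 * k ^ 3 - x * k)) atTop atBot :=
      tendsto_atBot_add_const_right _ _
        ((tendsto_pow_atTop two_ne_zero).const_mul_atTop_of_neg (by linarith))
    refine (Real.tendsto_exp_atBot.comp h1).congr fun r => ?_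
    rw [norm_cubicExp]
    simp
    ring
  have h2 := integral_Ioi_of_hasDerivAt_of_tendsto' (a := (0 : ℝ))
    (f := fun r : ℝ => cubicExp (1 / 3) x (k + I * r))
    (f' := fun r => airyIntegrand k I 2 x r - x * airyIntegrand k I 0 x r) (fun r _ => ?_)
    hint h0
  · rw [integral_sub (integrableOn_airyIntegrand hray 2 x)
      ((integrableOn_airyIntegrand hray 0 x).const_mul (x : ℂ)), integral_const_mul] at h2
    have h3 := congrArg Complex.im h2
    have h4 : (cubicExp (1 / 3) x k).im = 0 := by
      have : ((1 / 3 : ℝ) : ℂ) * (k : ℂ) ^ 3 - x * k = ((1 / 3 * k ^ 3 - x * k : ℝ) : ℂ) := by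
        push_cast; ring
      rw [cubicExp, this, ← Complex.ofReal_exp, Complex.ofReal_im]
    simp only [Complex.sub_im, Complex.ofReal_zero, mul_zero, add_zero, h4, sub_self,
      Complex.im_ofReal_mul, Complex.zero_im] at h3
    simp only [airyMoment]
    linarith
  · have hl := hasDerivAt_line k I r
    have h5 := ((hl.pow 3).const_mul ((1 / 3 : ℝ) : ℂ)).sub (hl.const_mul (x : ℂ))
    have h6 := h5.cexp
    refine h6.congr_deriv ?_
    simp only [airyIntegrand, cubicExp, Pi.sub_apply]
    simp
    ring

/-- The Airy equation. -/
theorem hasDerivAt_airyAiPrime (x : ℝ) : HasDerivAt airyAiPrime (x * airyAi x) x := by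
  have h := hasDerivAt_const_mul_im (hasDerivAt_airyMoment (isAiryRay_vertical one_pos) 1 x).neg
    (1 / π)
  refine h.congr_deriv ?_
  rw [neg_neg, airyMoment_two_im 1 one_pos, airyAi_eq_vertical one_pos]
  ring

@[fun_prop]
theorem continuous_airyAiPrime : Continuous airyAiPrime :=
  continuous_iff_continuousAt.2 fun x => (hasDerivAt_airyAiPrime x).continuousAt

/-- The freedom in k comes from moving the vertical line. An arbitrary rate is needed later to
offset the growth allowed to Ai(xw) when x < 0. -/
theorem exists_abs_airyAi_le (k : ℝ) (hk : 0 < k) :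
    ∃ C : ℝ, 0 ≤ C ∧ ∀ x : ℝ, |airyAi x| ≤ C * Real.exp (-k * x) ∧
      |airyAiPrime x| ≤ C * Real.exp (-k * x) := by
  obtain ⟨C₀, h0, hC₀⟩ := norm_airyMoment_le k 0
  obtain ⟨C₁, h1, hC₁⟩ := norm_airyMoment_le k 1
  have key : ∀ (z : ℂ) (C e : ℝ), 0 ≤ e → ‖z‖ ≤ C * e → C ≤ C₀ + C₁ →
      |1 / π * z.im| ≤ 1 / π * (C₀ + C₁) * e := by
    intro z C e he hz hC
    rw [abs_mul, abs_of_pos (by positivity), mul_assoc]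
    refine mul_le_mul_of_nonneg_left ?_ (by positivity)
    exact (Complex.abs_im_le_norm z).trans (hz.trans (mul_le_mul_of_nonneg_right hC he))
  refine ⟨1 / π * (C₀ + C₁), by positivity, fun x => ⟨?_, ?_⟩⟩
  · rw [airyAi_eq_vertical hk]
    exact key _ C₀ _ (Real.exp_pos _).le (hC₀ x) (by linarith)
  · rw [(hasDerivAt_airyAi x).unique (hasDerivAt_airyAi_of_ray (isAiryRay_vertical hk) hk.le
      (by simp) (by simp) x)]
    refine key _ C₁ _ (Real.exp_pos _).le ?_ (by linarith)
    rw [norm_neg]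
    exact hC₁ x

/-! ### Values of Ai and Ai' at zero, and the sign of Ai. -/

theorem sixthRoot_re_lt_im : sixthRoot.re < sixthRoot.im := by
  have : (1 : ℝ) < √3 := by rw [Real.lt_sqrt] <;> norm_num
  rw [sixthRoot_re, sixthRoot_im]; linarith

theorem integral_rpow_mul_exp_cube {q : ℝ} (hq : -1 < q) :
    ∫ r in Set.Ioi (0 : ℝ), r ^ q * Real.exp (-r ^ 3 / 3) =
      (1 / 3 : ℝ) ^ (-(q + 1) / 3) * (1 / 3) * Real.Gamma ((q + 1) / 3) := by
  rw [← integral_rpow_mul_exp_neg_mul_rpow (p := 3) (q := q) (b := 1 / 3) (by norm_num) hq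
    (by norm_num)]
  refine setIntegral_congr_fun measurableSet_Ioi fun r _ => ?_
  simp only [Real.rpow_ofNat]
  congr 2
  ring

/-- Along the ray of angle π/3, q³ = -r³, so the integral is a real Gamma integral times the
direction. -/
theorem airyAi_zero : airyAi 0 =
    1 / π * (√3 / 2) * ((1 / 3 : ℝ) ^ (-(1 / 3) : ℝ) * (1 / 3) * Real.Gamma (1 / 3)) := by
  rw [airyAi_eq_of_ray isAiryRay_sixthRoot le_rfl (by norm_num [sixthRoot_re]) sixthRoot_re_lt_im]
  have h := integral_rpow_mul_exp_cube (q := 0) (by norm_num)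
  simp only [Real.rpow_zero, one_mul, zero_add] at h
  rw [neg_div] at h
  rw [← h, mul_assoc, airyMoment]
  simp only [airyIntegrand, pow_zero, one_mul, Complex.ofReal_zero, zero_add, cubicExp_sixthRoot]
  rw [integral_mul_const, integral_complex_ofReal, Complex.im_ofReal_mul, sixthRoot_im]
  ring

theorem airyAiPrime_zero : airyAiPrime 0 =
    -(1 / π * (√3 / 2) * ((1 / 3 : ℝ) ^ (-(2 / 3) : ℝ) * (1 / 3) * Real.Gamma (2 / 3))) := by
  rw [(hasDerivAt_airyAi 0).unique (hasDerivAt_airyAi_of_ray isAiryRay_sixthRoot le_rfl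
    (by norm_num [sixthRoot_re]) sixthRoot_re_lt_im 0)]
  have h := integral_rpow_mul_exp_cube (q := 1) (by norm_num)
  simp only [Real.rpow_one] at h
  rw [neg_div, show (1 + 1 : ℝ) / 3 = 2 / 3 by norm_num] at h
  rw [← h, mul_assoc, airyMoment]
  have : ∀ r : ℝ, airyIntegrand 0 sixthRoot 1 0 r =
      ((r * Real.exp (-r ^ 3 / 3) : ℝ) : ℂ) * sixthRoot ^ 2 := by
    intro r
    simp only [airyIntegrand, Complex.ofReal_zero, zero_add, cubicExp_sixthRoot]
    push_cast
    ring
  simp only [this]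
  rw [integral_mul_const, integral_complex_ofReal, Complex.neg_im, Complex.im_ofReal_mul, sixthRoot_pow_two]
  ring

theorem airyAi_zero_pos : 0 < airyAi 0 := by
  rw [airyAi_zero]
  have := Real.Gamma_pos_of_pos (s := 1 / 3) (by norm_num)
  positivity

/-- The Gamma values combine by the reflection formula, so neither is needed separately. -/
theorem airyAi_zero_mul_airyAiPrime_zero : airyAi 0 * airyAiPrime 0 = -(1 / (2 * π * √3)) := by
  have hG : Real.Gamma (1 / 3) * Real.Gamma (2 / 3) = π / (√3 / 2) := by
    rw [← Real.sin_pi_div_three, show (2 / 3 : ℝ) = 1 - 1 / 3 by norm_num,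
      Real.Gamma_mul_Gamma_one_sub]
    congr 2; ring
  have hp : (1 / 3 : ℝ) ^ (-(1 / 3) : ℝ) * (1 / 3 : ℝ) ^ (-(2 / 3) : ℝ) = 3 := by
    rw [← Real.rpow_add (by norm_num), show (-(1 / 3) + -(2 / 3) : ℝ) = -1 by norm_num,
      Real.rpow_neg_one]
    norm_num
  rw [airyAi_zero, airyAiPrime_zero]
  calc _ = -(1 / π ^ 2 * (√3 ^ 2 / 4) * (1 / 9) *
        ((1 / 3 : ℝ) ^ (-(1 / 3) : ℝ) * (1 / 3 : ℝ) ^ (-(2 / 3) : ℝ)) *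
        (Real.Gamma (1 / 3) * Real.Gamma (2 / 3))) := by ring
    _ = _ := by
      rw [hG, hp, sqrt_three_sq]
      field_simp
      norm_num

theorem tendsto_exp_neg_mul_atTop {k : ℝ} (hk : 0 < k) (C : ℝ) :
    Tendsto (fun x : ℝ => C * Real.exp (-k * x)) atTop (𝓝 0) := by
  have := (Real.tendsto_exp_atBot.comp
    (tendsto_id.const_mul_atTop_of_neg (neg_neg_of_pos hk))).const_mul C
  simpa using this

/-- By the Airy equation (Ai Ai')' = Ai'² + x Ai² ≥ 0 on x ≥ 0, and Ai Ai' tends to 0, so Ai Ai' ≤ 0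
and Ai² decreases. Since Ai(0) > 0, a negative value would force an earlier zero, after which Ai²
would have to stay 0. -/
theorem airyAi_nonneg {x : ℝ} (hx : 0 ≤ x) : 0 ≤ airyAi x := by
  have hd : ∀ x, HasDerivAt (fun x => airyAi x * airyAiPrime x)
      (airyAiPrime x ^ 2 + x * airyAi x ^ 2) x := by
    intro x
    exact ((hasDerivAt_airyAi x).mul (hasDerivAt_airyAiPrime x)).congr_deriv (by ring)
  have hmono : MonotoneOn (fun x => airyAi x * airyAiPrime x) (Set.Ici 0) := by
    refine monotoneOn_of_deriv_nonneg (convex_Ici 0)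
      (continuous_airyAi.mul continuous_airyAiPrime).continuousOn
      (fun x _ => (hd x).differentiableAt.differentiableWithinAt) fun x hx => ?_
    rw [(hd x).deriv]
    rw [interior_Ici] at hx
    have : 0 ≤ x := le_of_lt hx
    positivity
  obtain ⟨C, hC, hb⟩ := exists_abs_airyAi_le 1 one_pos
  have hlim : Tendsto (fun x => airyAi x * airyAiPrime x) atTop (𝓝 0) := by
    refine squeeze_zero_norm (fun x => ?_) (tendsto_exp_neg_mul_atTop two_pos (C * C))
    rw [norm_mul]
    refine (mul_le_mul (hb x).1 (hb x).2 (abs_nonneg _) (by positivity)).trans (le_of_eq ?_)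
    rw [show -2 * x = -1 * x + -1 * x by ring, Real.exp_add]
    ring
  have hneg : ∀ x, 0 ≤ x → airyAi x * airyAiPrime x ≤ 0 := by
    intro x hx
    refine ge_of_tendsto hlim ?_
    filter_upwards [eventually_ge_atTop x] with y hy
    exact hmono hx (hx.trans hy : (0 : ℝ) ≤ y) hy
  have hd2 : ∀ x, HasDerivAt (fun x => airyAi x ^ 2) (2 * (airyAi x * airyAiPrime x)) x := by
    intro x
    exact ((hasDerivAt_airyAi x).pow 2).congr_deriv (by ring)
  have hanti : AntitoneOn (fun x => airyAi x ^ 2) (Set.Ici 0) := by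
    refine antitoneOn_of_deriv_nonpos (convex_Ici 0) (continuous_airyAi.pow 2).continuousOn
      (fun x _ => (hd2 x).differentiableAt.differentiableWithinAt) fun x hx => ?_
    rw [interior_Ici] at hx
    rw [(hd2 x).deriv]
    linarith [hneg x (le_of_lt hx)]
  by_contra! hlt
  obtain ⟨y, hy, hy0⟩ := intermediate_value_Icc' hx continuous_airyAi.continuousOn
    ⟨hlt.le, airyAi_zero_pos.le⟩
  have := hanti hy.1 hx hy.2
  simp only [hy0] at this
  nlinarith

/-! ### The fundamental solution as a rescaled Airy function. -/

theorem cubeRoot_pow_three {a : ℝ} (ha : 0 ≤ a) : (a ^ (1 / 3 : ℝ)) ^ 3 = a := by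
  rw [← Real.rpow_natCast, ← Real.rpow_mul ha]
  norm_num

theorem tendsto_scaledAiry (x : ℝ) {s : ℝ} (hs : 0 < s) :
    Tendsto (fun R : ℝ => (1 / π) * ∫ β in (0 : ℝ)..R, Real.cos (β * x + β ^ 3 * s)) atTop
      (𝓝 (scaledAiry x s)) := by
  have hc3 : ((3 * s) ^ (1 / 3 : ℝ)) ^ 3 = 3 * s := cubeRoot_pow_three (by positivity)
  have hc : 0 < (3 * s) ^ (1 / 3 : ℝ) := by positivity
  rw [scaledAiry]
  set c := (3 * s) ^ (1 / 3 : ℝ)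
  have h := ((tendsto_airyAi (x / c)).comp (tendsto_id.const_mul_atTop hc)).const_mul (1 / c)
  refine h.congr fun R => ?_
  have h2 := intervalIntegral.integral_comp_mul_left (a := 0) (b := R)
    (fun z => Real.cos (z ^ 3 / 3 + x / c * z)) hc.ne'
  have h3 : ∀ β : ℝ, (c * β) ^ 3 / 3 + x / c * (c * β) = β * x + β ^ 3 * s := by
    intro β
    rw [mul_pow, hc3]
    field_simp
    ring
  simp only [h3, mul_zero, smul_eq_mul] at h2
  rw [h2]
  simp only [Function.comp_apply, id]
  ring

theorem heatKernel3_eq_scaledAiry (x : ℝ) {s : ℝ} (hs : 0 < s) :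
    heatKernel3 x s = scaledAiry x s :=
  (tendsto_scaledAiry x hs).limUnder_eq

theorem tendsto_fourier_heatKernel3 (x : ℝ) {s : ℝ} (hs : 0 < s) :
    Tendsto (fun R : ℝ => (1 / (2 * π) : ℂ) * ∫ β in (-R)..R,
        Complex.exp (-Complex.I * ((β * x : ℝ) : ℂ) - Complex.I * ((s * β ^ 3 : ℝ) : ℂ)))
      atTop (𝓝 (heatKernel3 x s : ℂ)) := by
  rw [heatKernel3_eq_scaledAiry x hs]
  refine ((Complex.continuous_ofReal.tendsto _).comp (tendsto_scaledAiry x hs)).congr fun R => ?_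
  set f : ℝ → ℂ := fun β =>
    Complex.exp (-Complex.I * ((β * x : ℝ) : ℂ) - Complex.I * ((s * β ^ 3 : ℝ) : ℂ))
  have hf : Continuous f := by fun_prop
  have h1 : ∫ β in (-R)..R, f β = ∫ β in (0 : ℝ)..R, (f (-β) + f β) := by
    rw [intervalIntegral.integral_add (Continuous.intervalIntegrable (by fun_prop) _ _)
      (hf.intervalIntegrable _ _), intervalIntegral.integral_comp_neg, neg_zero,
      intervalIntegral.integral_add_adjacent_intervals (hf.intervalIntegrable _ _)
      (hf.intervalIntegrable _ _)]
  have h2 : ∀ β : ℝ, f (-β) + f β = ((2 * Real.cos (β * x + β ^ 3 * s) : ℝ) : ℂ) := by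
    intro β
    have e1 : f (-β) = Complex.exp (((β * x + β ^ 3 * s : ℝ) : ℂ) * I) := by
      simp only [f]; congr 1; push_cast; ring
    have e2 : f β = Complex.exp (-((β * x + β ^ 3 * s : ℝ) : ℂ) * I) := by
      simp only [f]; congr 1; push_cast; ring
    rw [e1, e2, Complex.ofReal_mul, Complex.ofReal_cos, Complex.ofReal_ofNat, Complex.two_cos]
  rw [h1]
  simp only [h2, intervalIntegral.integral_ofReal, Function.comp_apply,
    intervalIntegral.integral_const_mul]
  push_cast
  ring

/-! ### Fourier inversion of the stable characteristic function. -/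

/-- The direction `exp (i π / 6)`. -/
noncomputable def twelfthRoot : ℂ := ⟨√3 / 2, 1 / 2⟩

theorem twelfthRoot_pow_three : twelfthRoot ^ 3 = I := by
  have h := sqrt_three_sq
  rw [pow_succ, pow_two]
  apply Complex.ext
  · simp [twelfthRoot]; linear_combination √3 / 8 * h
  · simp [twelfthRoot]; linear_combination 3 / 8 * h

theorem exp_pi_div_six_mul_I : Complex.exp (((π / 6 : ℝ) : ℂ) * I) = twelfthRoot := by
  apply Complex.ext
  · rw [Complex.exp_ofReal_mul_I_re, Real.cos_pi_div_six]; rfl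
  · rw [Complex.exp_ofReal_mul_I_im, Real.sin_pi_div_six]; rfl

/-- Negative frequencies are used because there the direction is exp(iπ/6), in the upper half plane
like the Airy contours. -/
theorem stableCharFun_third_neg (t : ℝ) {β : ℝ} (hβ : 0 < β) :
    stableCharFun (1 / 3) (1 / 3) t (-β) =
      Complex.exp (-((t * β ^ (1 / 3 : ℝ) : ℝ) : ℂ) * twelfthRoot) := by
  rw [stableCharFun, ← exp_pi_div_six_mul_I, abs_neg, abs_of_pos hβ,
    Real.sign_of_neg (neg_neg_of_pos hβ)]
  congr 3
  push_cast
  ring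

theorem stableCharFun_conj (t β : ℝ) : stableCharFun (1 / 3) (1 / 3) t (-β) =
    starRingEnd ℂ (stableCharFun (1 / 3) (1 / 3) t β) := by
  rw [stableCharFun, stableCharFun, ← Complex.exp_conj, map_mul, ← Complex.exp_conj]
  simp only [map_neg, map_mul, Complex.conj_ofReal, Complex.conj_I, abs_neg, Real.sign_neg]
  congr 3
  push_cast
  ring

theorem continuous_stableCharFun_third (t : ℝ) : Continuous (stableCharFun (1 / 3) (1 / 3) t) := by
  -- Separate terms for the positive and negative parts of β remove the jump of the sign function at
  -- 0.
  have h : stableCharFun (1 / 3) (1 / 3) t = fun β : ℝ => Complex.exp (-(t : ℂ) *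
      (((max β 0 ^ (1 / 3 : ℝ) : ℝ) : ℂ) * starRingEnd ℂ twelfthRoot +
        ((max (-β) 0 ^ (1 / 3 : ℝ) : ℝ) : ℂ) * twelfthRoot)) := by
    funext β
    rcases lt_trichotomy β 0 with h | rfl | h
    · have h1 := stableCharFun_third_neg t (neg_pos.2 h)
      rw [neg_neg] at h1
      rw [h1, max_eq_right h.le, max_eq_left (neg_pos.2 h).le, Real.zero_rpow (by norm_num)]
      congr 1
      push_cast
      ring
    · simp [stableCharFun]
    · have h1 := congrArg (starRingEnd ℂ) (stableCharFun_third_neg t h)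
      rw [stableCharFun_conj, Complex.conj_conj, ← Complex.exp_conj] at h1
      rw [h1, max_eq_left h.le, max_eq_right (neg_neg_of_pos h).le, Real.zero_rpow (by norm_num)]
      congr 1
      simp only [map_mul, map_neg, Complex.conj_ofReal]
      push_cast
      ring
  rw [h]
  have h1 : Continuous fun β : ℝ => max β 0 ^ (1 / 3 : ℝ) :=
    Continuous.rpow_const (by fun_prop) fun _ => Or.inr (by norm_num)
  have h2 : Continuous fun β : ℝ => max (-β) 0 ^ (1 / 3 : ℝ) :=
    Continuous.rpow_const (by fun_prop) fun _ => Or.inr (by norm_num)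
  fun_prop

theorem integrable_stableCharFun_third {t : ℝ} (ht : 0 < t) :
    Integrable (stableCharFun (1 / 3) (1 / 3) t) := by
  have h1 : IntegrableOn (fun β => stableCharFun (1 / 3) (1 / 3) t (-β)) (Set.Ioi 0) := by
    have h := integrableOn_rpow_mul_exp_neg_mul_rpow (p := 1 / 3) (s := 0) (b := t * (√3 / 2))
      (by norm_num) (by norm_num) (by positivity)
    refine Integrable.mono' h
      ((continuous_stableCharFun_third t).comp continuous_neg).aestronglyMeasurable ?_
    filter_upwards [ae_restrict_mem measurableSet_Ioi] with β hβ
    rw [stableCharFun_third_neg t hβ, Complex.norm_exp, Real.rpow_zero, one_mul, Real.exp_le_exp,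
      ← Complex.ofReal_neg, Complex.re_ofReal_mul]
    apply le_of_eq
    simp only [twelfthRoot]
    ring
  have h2 : IntegrableOn (stableCharFun (1 / 3) (1 / 3) t) (Set.Ioi 0) := by
    refine Integrable.mono' h1.norm (continuous_stableCharFun_third t).aestronglyMeasurable
      (ae_of_all _ fun β => ?_)
    rw [stableCharFun_conj, RCLike.norm_conj]
  have h3 : IntegrableOn (stableCharFun (1 / 3) (1 / 3) t) (Set.Iic 0) := by
    rw [integrableOn_Iic_iff_integrableOn_Iio]
    rw [← (Measure.measurePreserving_neg (volume : Measure ℝ)).integrableOn_comp_preimage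
      (MeasurableEquiv.neg ℝ).measurableEmbedding]
    have h0 : Neg.neg ⁻¹' Set.Iio (0 : ℝ) = Set.Ioi 0 := by ext x; simp
    rw [h0]
    exact h1
  rw [← integrableOn_univ, ← Set.Iic_union_Ioi (a := (0 : ℝ))]
  exact h3.union h2

/-- The integrand of the inversion formula after the substitution `β = r³`. -/
noncomputable def stableRayIntegrand (s t r : ℝ) : ℂ :=
  3 * (twelfthRoot * r) ^ 2 * cubicExp s t (twelfthRoot * r) * twelfthRoot

/-- With q = exp(iπ/6) r one has q³ = i r³, so i s β = s q³ and dβ = -i · 3q² dq. -/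
theorem smul_comp_cube {s t r : ℝ} (hr : 0 < r) :
    (|(3 : ℝ)| * r ^ ((3 : ℝ) - 1)) • (Complex.exp (I * ((r ^ (3 : ℝ) * s : ℝ) : ℂ)) *
      stableCharFun (1 / 3) (1 / 3) t (-r ^ (3 : ℝ))) = -I * stableRayIntegrand s t r := by
  have h3 : r ^ (3 : ℝ) = r ^ 3 := by norm_cast
  have h2 : r ^ ((3 : ℝ) - 1) = r ^ 2 := by norm_num
  have h1 : (r ^ 3) ^ (1 / 3 : ℝ) = r := by
    rw [← Real.rpow_natCast, ← Real.rpow_mul hr.le]; norm_num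
  rw [h3, h2, stableCharFun_third_neg t (by positivity), h1, stableRayIntegrand, cubicExp,
    ← Complex.exp_add, mul_pow, mul_pow, twelfthRoot_pow_three, Complex.real_smul]
  have h4 : -I * (3 * (twelfthRoot ^ 2 * (r : ℂ) ^ 2) *
      Complex.exp (s * (I * r ^ 3) - t * (twelfthRoot * r)) * twelfthRoot) =
      (-I * twelfthRoot ^ 3) * (3 * r ^ 2) *
        Complex.exp (s * (I * r ^ 3) - t * (twelfthRoot * r)) := by ring
  rw [h4, twelfthRoot_pow_three, neg_mul I I, Complex.I_mul_I, neg_neg, one_mul]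
  push_cast
  rw [abs_of_pos (by norm_num)]
  push_cast
  congr 2
  ring

/-- The two half-lines contribute conjugate values, so the inversion integral is twice a real part;
the factor -i from the substitution turns it into an imaginary part. -/
theorem stableDensity_third_eq {t : ℝ} (ht : 0 < t) (s : ℝ) :
    IntegrableOn (stableRayIntegrand s t) (Set.Ioi 0) ∧
    stableDensity (1 / 3) (1 / 3) s t =
      ((1 / π * (∫ r in Set.Ioi (0 : ℝ), stableRayIntegrand s t r).im : ℝ) : ℂ) := by
  set g : ℝ → ℂ := fun β => Complex.exp (I * ((β * s : ℝ) : ℂ)) *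
    stableCharFun (1 / 3) (1 / 3) t (-β) with hg
  have hgi : Integrable g := by
    refine Integrable.mono' (integrable_stableCharFun_third ht).comp_neg.norm
      (Continuous.aestronglyMeasurable ?_) (ae_of_all _ fun β => ?_)
    · have := continuous_stableCharFun_third t
      fun_prop
    · rw [hg, norm_mul, mul_comm I, Complex.norm_exp_ofReal_mul_I, one_mul]
  have hsub : Set.EqOn (fun r => (|(3 : ℝ)| * r ^ ((3 : ℝ) - 1)) • g (r ^ (3 : ℝ)))
      (fun r => -I * stableRayIntegrand s t r) (Set.Ioi 0) := fun r hr => smul_comp_cube hr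
  have hi := (integrableOn_Ioi_comp_rpow_iff g (p := 3) (by norm_num)).2 hgi.integrableOn
  rw [integrableOn_congr_fun hsub measurableSet_Ioi] at hi
  have hi2 : IntegrableOn (stableRayIntegrand s t) (Set.Ioi 0) := by
    refine (hi.const_mul I).congr (ae_of_all _ fun r => ?_)
    simp only
    rw [← mul_assoc, mul_neg, Complex.I_mul_I, neg_neg, one_mul]
  refine ⟨hi2, ?_⟩
  have hE : ∫ β in Set.Ioi (0 : ℝ), g β =
      -I * ∫ r in Set.Ioi (0 : ℝ), stableRayIntegrand s t r := by
    rw [← integral_comp_rpow_Ioi g (p := 3) (by norm_num),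
      setIntegral_congr_fun measurableSet_Ioi hsub, integral_const_mul]
  have hneg : ∀ β, Complex.exp (-Complex.I * ((β * s : ℝ) : ℂ)) *
      stableCharFun (1 / 3) (1 / 3) t β = starRingEnd ℂ (g β) := by
    intro β
    simp only [hg]
    rw [stableCharFun_conj, map_mul, Complex.conj_conj, ← Complex.exp_conj, map_mul,
      Complex.conj_I, Complex.conj_ofReal]
  have hflip : ∀ β, starRingEnd ℂ (g (-β)) = g β := by
    intro β
    rw [← hneg]
    simp only [hg]
    congr 2
    push_cast
    ring
  rw [stableDensity]
  simp only [hneg]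
  rw [integral_conj, ← intervalIntegral.integral_Iic_add_Ioi (b := (0 : ℝ)) hgi.integrableOn
    hgi.integrableOn]
  have h0 : ∫ β in Set.Iic (0 : ℝ), g β = starRingEnd ℂ (∫ β in Set.Ioi (0 : ℝ), g β) := by
    have := integral_comp_neg_Ioi 0 g
    rw [neg_zero] at this
    rw [← this, ← integral_conj]
    congr 1
    ext β
    rw [← hflip, neg_neg]
  rw [h0, hE]
  set L := ∫ r in Set.Ioi (0 : ℝ), stableRayIntegrand s t r
  apply Complex.ext <;> simp
  · ring

/-- Integration by parts: the derivative of exp(s q³ - t q) is (3s q² - t) exp(s q³ - t q). -/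
theorem stableRay_parts (s t Y : ℝ) :
    s * ∫ r in (0 : ℝ)..Y, stableRayIntegrand s t r = cubicExp s t (twelfthRoot * Y) - 1 +
      t * cubicPrimitive s t (twelfthRoot * Y) := by
  have hc : Continuous (stableRayIntegrand s t) := by unfold stableRayIntegrand; fun_prop
  have hl := integral_cubicExp_line s t 0 twelfthRoot 0 Y
  simp only [zero_add, Complex.ofReal_zero, mul_zero, cubicPrimitive_zero, sub_zero] at hl
  have hd : ∫ r in (0 : ℝ)..Y, (s * stableRayIntegrand s t r -
      t * (cubicExp s t (twelfthRoot * r) * twelfthRoot)) =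
      cubicExp s t (twelfthRoot * Y) - cubicExp s t (twelfthRoot * (0 : ℝ)) := by
    refine intervalIntegral.integral_eq_sub_of_hasDerivAt
      (f := fun r : ℝ => cubicExp s t (twelfthRoot * r)) (fun r _ => ?_)
      (Continuous.intervalIntegrable (by fun_prop) _ _)
    have hl := hasDerivAt_line 0 twelfthRoot r
    simp only [zero_add] at hl
    have h5 := (((hl.pow 3).const_mul (s : ℂ)).sub (hl.const_mul (t : ℂ))).cexp
    refine h5.congr_deriv ?_
    simp only [stableRayIntegrand, cubicExp, Pi.sub_apply, Pi.pow_apply]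
    push_cast
    ring
  rw [intervalIntegral.integral_sub (Continuous.intervalIntegrable (by fun_prop) _ _)
    (Continuous.intervalIntegrable (by fun_prop) _ _), intervalIntegral.integral_const_mul,
    intervalIntegral.integral_const_mul, hl] at hd
  have h0 : cubicExp s t (twelfthRoot * (0 : ℝ)) = 1 := by simp [cubicExp]
  rw [h0] at hd
  linear_combination hd

theorem twelfthRoot_mul (y : ℝ) : twelfthRoot * ((2 * y : ℝ) : ℂ) = (√3 * y : ℝ) + I * y := by
  apply Complex.ext <;> simp [twelfthRoot]
  ring

/-- On the ray Re q³ = 0, so the boundary term has modulus exp(-t√3 y) whatever the sign of s, and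
the boundary value 1 at the origin is real. Radius 2y puts the endpoint at height y. -/
theorem tendsto_stableRay_parts {s t : ℝ} (ht : 0 < t) :
    Tendsto (fun y : ℝ => t * (cubicPrimitive s t ((√3 * y : ℝ) + I * y)).im) atTop
      (𝓝 (s * (∫ r in Set.Ioi (0 : ℝ), stableRayIntegrand s t r).im)) := by
  have h1 := intervalIntegral_tendsto_integral_Ioi 0 (stableDensity_third_eq ht s).1
    (tendsto_id.const_mul_atTop (two_pos (α := ℝ)))
  have h2 := ((Complex.continuous_im.tendsto _).comp h1).const_mul s
  have h3 : Tendsto (fun y : ℝ => (cubicExp s t ((√3 * y : ℝ) + I * y)).im) atTop (𝓝 0) := by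
    refine squeeze_zero_norm (fun y => (Complex.abs_im_le_norm _).trans_eq ?_)
      (tendsto_exp_neg_mul_atTop (k := t * √3) (by positivity) 1)
    rw [norm_cubicExp, one_mul]
    congr 1
    simp
    have := sqrt_three_sq
    have h3 : √3 ^ 3 = 3 * √3 := by rw [pow_succ, this]
    rw [mul_pow, h3]
    ring
  have h4 := h2.sub h3
  rw [sub_zero] at h4
  refine h4.congr fun y => ?_
  have h5 := congrArg Complex.im (stableRay_parts s t (2 * y))
  rw [twelfthRoot_mul] at h5
  simp only [Complex.im_ofReal_mul, Complex.add_im, Complex.sub_im, Complex.one_im, sub_zero] at h5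
  simp only [Function.comp_apply, id, h5]
  ring

theorem stableDensity_third_of_pos {s t : ℝ} (hs : 0 < s) (ht : 0 < t) :
    stableDensity (1 / 3) (1 / 3) s t = (airyStableDensity s t : ℂ) := by
  have h1 := tendsto_stableRay_parts (s := s) ht
  have h2 := (Complex.continuous_im.tendsto _).comp (tendsto_cubicPrimitive_ray_pos hs ht)
  have h3 : Tendsto (fun y : ℝ => (cubicPrimitive s t (I * y)).im) atTop
      (𝓝 (π * scaledAiry t s)) := by
    refine ((tendsto_scaledAiry t hs).const_mul π).congr fun y => ?_
    rw [cubicPrimitive_I_mul_im, ← mul_assoc, mul_one_div_cancel Real.pi_ne_zero, one_mul]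
    congr 1
    ext z
    congr 1
    ring
  have h4 := (h2.add h3).const_mul t
  have h5 := tendsto_nhds_unique h1 (h4.congr fun y => by simp)
  rw [(stableDensity_third_eq ht s).2, airyStableDensity]
  simp only [Complex.zero_im, zero_add] at h5
  congr 1
  have hpi := Real.pi_ne_zero
  field_simp
  linarith

theorem stableDensity_third_of_neg {s t : ℝ} (hs : s < 0) (ht : 0 < t) :
    stableDensity (1 / 3) (1 / 3) s t = 0 := by
  have h1 := tendsto_stableRay_parts (s := s) ht
  have h2 := (Complex.continuous_im.tendsto _).comp (tendsto_cubicPrimitive_ray_neg hs.le ht)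
  have h5 := tendsto_nhds_unique h1 ((h2.const_mul t).congr fun y => by
    rw [Function.comp_apply, Complex.sub_im, cubicPrimitive_ofReal_im, sub_zero])
  simp only [Complex.zero_im, mul_zero, mul_eq_zero, hs.ne, false_or] at h5
  rw [(stableDensity_third_eq ht s).2, h5]
  simp

/-! ### The Airy density and the stable law of order 1/3. -/

/-- The substitution `w = (3 s)^{-1/3}`. -/
theorem comp_inv_cubeRoot (g : ℝ → ℝ) :
    (IntegrableOn (fun s : ℝ => (1 / (3 * s) ^ (1 / 3 : ℝ)) ^ 4 * g (1 / (3 * s) ^ (1 / 3 : ℝ)))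
      (Set.Ioi 0) ↔ IntegrableOn g (Set.Ioi 0)) ∧
    ∫ s in Set.Ioi (0 : ℝ), (1 / (3 * s) ^ (1 / 3 : ℝ)) ^ 4 * g (1 / (3 * s) ^ (1 / 3 : ℝ)) =
      ∫ w in Set.Ioi (0 : ℝ), g w := by
  set G : ℝ → ℝ := fun x => (|(-(1 / 3) : ℝ)| * x ^ ((-(1 / 3) : ℝ) - 1)) • g (x ^ (-(1 / 3) : ℝ))
  have hG1 := integrableOn_Ioi_comp_rpow_iff g (p := -(1 / 3)) (by norm_num)
  have hG2 := integral_comp_rpow_Ioi g (p := -(1 / 3)) (by norm_num)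
  have h1 := integrableOn_Ioi_comp_mul_left_iff G 0 (a := 3) (by norm_num)
  have h2 := integral_comp_mul_left_Ioi G 0 (b := 3) (by norm_num)
  rw [mul_zero] at h1 h2
  have h3 : Set.EqOn
      (fun s : ℝ => (1 / (3 * s) ^ (1 / 3 : ℝ)) ^ 4 * g (1 / (3 * s) ^ (1 / 3 : ℝ)))
      (fun s => 3 * G (3 * s)) (Set.Ioi 0) := by
    intro s hs
    have hs : 0 < 3 * s := mul_pos three_pos hs
    have h4 : 1 / (3 * s) ^ (1 / 3 : ℝ) = (3 * s) ^ (-(1 / 3) : ℝ) := by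
      rw [Real.rpow_neg hs.le, one_div]
    have h5 : ((3 * s) ^ (-(1 / 3) : ℝ)) ^ 4 = (3 * s) ^ ((-(1 / 3) : ℝ) - 1) := by
      rw [← Real.rpow_natCast, ← Real.rpow_mul hs.le]
      norm_num
    simp only [G]
    rw [h4, h5, abs_neg, abs_of_pos (by norm_num), smul_eq_mul]
    ring
  constructor
  · rw [integrableOn_congr_fun h3 measurableSet_Ioi, ← hG1, ← h1]
    refine ⟨fun h => ?_, fun h => h.const_mul 3⟩
    refine (h.const_mul (1 / 3)).congr (ae_of_all _ fun s => ?_)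
    simp only
    ring
  · rw [setIntegral_congr_fun measurableSet_Ioi h3, integral_const_mul, h2, hG2, smul_eq_mul]
    ring

theorem airyStableDensity_eq (t : ℝ) {s : ℝ} (hs : 0 < s) :
    airyStableDensity s t = (1 / (3 * s) ^ (1 / 3 : ℝ)) ^ 4 *
      (3 * t * airyAi (t * (1 / (3 * s) ^ (1 / 3 : ℝ)))) := by
  have h := cubeRoot_pow_three (a := 3 * s) (by positivity)
  have hc : 0 < (3 * s) ^ (1 / 3 : ℝ) := by positivity
  rw [airyStableDensity, scaledAiry]
  set c := (3 * s) ^ (1 / 3 : ℝ)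
  have h1 : s = c ^ 3 / 3 := by linarith
  rw [h1, mul_one_div]
  field_simp

theorem airyStableDensity_nonneg {s t : ℝ} (hs : 0 < s) (ht : 0 < t) :
    0 ≤ airyStableDensity s t := by
  rw [airyStableDensity_eq t hs]
  have := airyAi_nonneg (x := t * (1 / (3 * s) ^ (1 / 3 : ℝ))) (by positivity)
  positivity

theorem integrableOn_exp_neg_mul_Ioi {k : ℝ} (hk : 0 < k) :
    IntegrableOn (fun w : ℝ => Real.exp (-k * w)) (Set.Ioi 0) :=
  exp_neg_integrableOn_Ioi 0 hk

theorem integrableOn_airyStableDensity {t : ℝ} (ht : 0 < t) :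
    IntegrableOn (fun s => airyStableDensity s t) (Set.Ioi 0) := by
  obtain ⟨C, -, hb⟩ := exists_abs_airyAi_le 1 one_pos
  have h1 : IntegrableOn (fun w => 3 * t * airyAi (t * w)) (Set.Ioi 0) := by
    refine Integrable.mono' ((integrableOn_exp_neg_mul_Ioi ht).const_mul (3 * t * C))
      (Continuous.aestronglyMeasurable (by fun_prop)) (ae_of_all _ fun w => ?_)
    rw [norm_mul, Real.norm_of_nonneg (by positivity), mul_assoc (3 * t)]
    refine mul_le_mul_of_nonneg_left ((hb (t * w)).1.trans (le_of_eq ?_)) (by positivity)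
    rw [neg_one_mul, neg_mul]
  exact ((comp_inv_cubeRoot fun w => 3 * t * airyAi (t * w)).1.2 h1).congr_fun
    (fun s hs => (airyStableDensity_eq t hs).symm) measurableSet_Ioi

/-- The factors 2π convert Mathlib's Fourier normalisation. The point w = 0 is left out because the
density was identified only for s ≠ 0. -/
theorem fourier_stableCharFun_third {t w : ℝ} (ht : 0 < t) (hw : w ≠ 0) :
    FourierTransform.fourier (stableCharFun (1 / 3) (1 / 3) t) w =
      2 * π * ((Set.Ioi 0).indicator (fun s => (airyStableDensity s t : ℂ)) (2 * π * w)) := by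
  have h0 : FourierTransform.fourier (stableCharFun (1 / 3) (1 / 3) t) w =
      2 * π * stableDensity (1 / 3) (1 / 3) (2 * π * w) t := by
    rw [Real.fourier_real_eq_integral_exp_smul, stableDensity, ← mul_assoc,
      mul_one_div_cancel (by simp [Real.pi_ne_zero]), one_mul]
    congr 1
    ext v
    rw [smul_eq_mul]
    congr 2
    push_cast
    ring
  rw [h0]
  have h2 := Real.two_pi_pos
  rcases lt_or_gt_of_ne hw with h | h
  · have h3 := mul_neg_of_pos_of_neg h2 h
    rw [stableDensity_third_of_neg h3 ht, Set.indicator_of_notMem (by simpa using h3.le)]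
  · have h3 := mul_pos h2 h
    rw [stableDensity_third_of_pos h3 ht, Set.indicator_of_mem (by simpa using h3)]

/-- The Fourier transform of the characteristic function is known almost everywhere and is
integrable; as the characteristic function is itself continuous and integrable, the inversion
theorem recovers it at every β. -/
theorem integral_exp_mul_airyStableDensity {t : ℝ} (ht : 0 < t) (β : ℝ) :
    ∫ s in Set.Ioi (0 : ℝ), Complex.exp (β * s * I) * (airyStableDensity s t : ℂ) =
      stableCharFun (1 / 3) (1 / 3) t β := by
  set f : ℝ → ℂ := (Set.Ioi 0).indicator fun s => (airyStableDensity s t : ℂ) with hf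
  have hfi : Integrable f :=
    (integrable_indicator_iff measurableSet_Ioi).2 (integrableOn_airyStableDensity ht).ofReal
  have hne : ∀ᵐ w : ℝ, w ≠ 0 := by
    rw [ae_iff]; simp
  have hF : FourierTransform.fourier (stableCharFun (1 / 3) (1 / 3) t) =ᵐ[volume]
      fun w => 2 * π * f (2 * π * w) := by
    filter_upwards [hne] with w hw using fourier_stableCharFun_third ht hw
  have hFi : Integrable (FourierTransform.fourier (stableCharFun (1 / 3) (1 / 3) t)) := by
    rw [integrable_congr hF]
    exact (hfi.comp_mul_left' Real.two_pi_pos.ne').const_mul _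
  have h := congrFun ((continuous_stableCharFun_third t).fourierInv_fourier_eq
    (integrable_stableCharFun_third ht) hFi) β
  rw [← h, Real.fourierInv_eq']
  have h1 : ∀ᵐ w : ℝ, Complex.exp (((2 * π * inner ℝ w β : ℝ) : ℂ) * I) •
      FourierTransform.fourier (stableCharFun (1 / 3) (1 / 3) t) w =
      (2 * π : ℝ) • (fun s : ℝ => Complex.exp (β * s * I) * f s) (2 * π * w) := by
    filter_upwards [hF] with w hw
    rw [hw]
    have : ((2 * π * inner ℝ w β : ℝ) : ℂ) = β * ((2 * π * w : ℝ) : ℂ) := by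
      rw [real_inner_eq_re_inner]; simp; ring
    rw [this]
    simp only [smul_eq_mul, Complex.real_smul]
    push_cast
    ring
  rw [integral_congr_ae h1, integral_smul,
    Measure.integral_comp_mul_left (fun s : ℝ => Complex.exp (β * s * I) * f s), smul_smul,
    abs_of_pos (by positivity), mul_inv_cancel₀ Real.two_pi_pos.ne', one_smul,
    ← integral_indicator measurableSet_Ioi]
  congr 1
  ext s
  by_cases hs : s ∈ Set.Ioi (0 : ℝ) <;> simp only [hf, Set.indicator_of_mem, hs,
    Set.indicator_of_notMem, not_false_eq_true, mul_zero]

theorem continuousOn_airyStableDensity (t : ℝ) :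
    ContinuousOn (fun s => airyStableDensity s t) (Set.Ioi 0) := by
  intro s hs
  refine ContinuousAt.continuousWithinAt ?_
  have hs : 0 < s := hs
  have h1 : (3 * s) ^ (1 / 3 : ℝ) ≠ 0 := by positivity
  have h2 : ContinuousAt (fun s : ℝ => (3 * s) ^ (1 / 3 : ℝ)) s :=
    ContinuousAt.rpow_const (by fun_prop) (Or.inr (by norm_num))
  unfold airyStableDensity scaledAiry
  refine ((continuousAt_const.div continuousAt_id hs.ne')).mul
    ((continuousAt_const.div h2 h1).mul ?_)
  exact continuous_airyAi.continuousAt.comp (continuousAt_const.div h2 h1)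

theorem aemeasurable_airyStableDensity (t : ℝ) :
    AEMeasurable (fun s => ENNReal.ofReal (airyStableDensity s t))
      (volume.restrict (Set.Ioi 0)) :=
  ((continuousOn_airyStableDensity t).aemeasurable measurableSet_Ioi).ennreal_ofReal

theorem integral_airyStableMeasure {E : Type*} [NormedAddCommGroup E] [NormedSpace ℝ E] {t : ℝ}
    (ht : 0 < t) (g : ℝ → E) :
    ∫ s, g s ∂airyStableMeasure t = ∫ s in Set.Ioi (0 : ℝ), airyStableDensity s t • g s := by
  rw [airyStableMeasure, integral_withDensity_eq_integral_toReal_smul₀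
    (aemeasurable_airyStableDensity t) (by simp)]
  refine setIntegral_congr_fun measurableSet_Ioi fun s hs => ?_
  simp only [ENNReal.toReal_ofReal (airyStableDensity_nonneg hs ht)]

theorem integrable_airyStableMeasure {t : ℝ} (ht : 0 < t) {g : ℝ → ℝ} :
    Integrable g (airyStableMeasure t) ↔
      IntegrableOn (fun s => airyStableDensity s t * g s) (Set.Ioi 0) := by
  rw [airyStableMeasure, integrable_withDensity_iff_integrable_smul₀'
    (aemeasurable_airyStableDensity t) (by simp)]
  refine integrableOn_congr_fun (fun s hs => ?_) measurableSet_Ioi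
  simp only [ENNReal.toReal_ofReal (airyStableDensity_nonneg hs ht), smul_eq_mul]

theorem isStableLaw_airyStableMeasure {t : ℝ} (ht : 0 < t) :
    IsStableLaw (1 / 3) (1 / 3) t (airyStableMeasure t) := by
  have hcf : ∀ β : ℝ, charFun (airyStableMeasure t) β = stableCharFun (1 / 3) (1 / 3) t β := by
    intro β
    rw [charFun_apply_real, integral_airyStableMeasure ht, ← integral_exp_mul_airyStableDensity ht]
    congr 1
    ext s
    rw [Complex.real_smul, mul_comm]
  refine ⟨?_, hcf⟩
  have hfin : IsFiniteMeasure (airyStableMeasure t) :=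
    isFiniteMeasure_withDensity_ofReal (integrableOn_airyStableDensity ht).2
  -- Total mass 1 is read off from the characteristic function at 0.
  have h0 := hcf 0
  rw [charFun_zero] at h0
  have h1 : stableCharFun (1 / 3) (1 / 3) t 0 = 1 := by simp [stableCharFun]
  rw [h1, Complex.ofReal_eq_one] at h0
  refine ⟨?_⟩
  rw [← ENNReal.toReal_eq_one_iff]
  exact h0

theorem isStableLaw_third_iff {t : ℝ} (ht : 0 < t) (ν : Measure ℝ) :
    IsStableLaw (1 / 3) (1 / 3) t ν ↔ ν = airyStableMeasure t := by
  have h := isStableLaw_airyStableMeasure ht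
  refine ⟨fun hν => ?_, fun hν => hν ▸ h⟩
  have := hν.1
  have := h.1
  exact Measure.ext_of_charFun (funext fun β => (hν.2 β).trans (h.2 β).symm)

/-! ### The Airy kernel integral in closed form. -/

theorem exists_abs_airyAi_mul_le {t M : ℝ} (ht : 0 < t) (hM : 0 ≤ M) :
    ∃ C : ℝ, 0 ≤ C ∧ ∀ x : ℝ, |x| ≤ M → ∀ w : ℝ, 0 ≤ w →
      |airyAi (x * w) * airyAi (t * w)| ≤ C * Real.exp (-2 * w) ∧
      |airyAi (x * w) * airyAiPrime (t * w)| ≤ C * Real.exp (-2 * w) ∧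
      |airyAiPrime (x * w) * airyAi (t * w)| ≤ C * Real.exp (-2 * w) := by
  obtain ⟨C, hC, h1⟩ := exists_abs_airyAi_le 1 one_pos
  -- Ai(xw) may be as large as exp(Mw); this rate makes Ai(tw) decay like exp(-(M + 2) w), leaving
  -- exp(-2w).
  obtain ⟨D, hD, h2⟩ := exists_abs_airyAi_le ((M + 2) / t) (by positivity)
  refine ⟨C * D, by positivity, fun x hx w hw => ?_⟩
  have key : ∀ u v : ℝ, |u| ≤ C * Real.exp (-1 * (x * w)) →
      |v| ≤ D * Real.exp (-((M + 2) / t) * (t * w)) → |u * v| ≤ C * D * Real.exp (-2 * w) := by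
    intro u v hu hv
    rw [abs_mul]
    refine (mul_le_mul hu hv (abs_nonneg _) (by positivity)).trans ?_
    rw [mul_mul_mul_comm, ← Real.exp_add]
    refine mul_le_mul_of_nonneg_left (Real.exp_le_exp.2 ?_) (by positivity)
    have h3 : -((M + 2) / t) * (t * w) = -((M + 2) * w) := by field_simp
    have h4 := mul_le_mul_of_nonneg_right ((neg_le_abs x).trans hx) hw
    rw [h3]
    linarith
  exact ⟨key _ _ (h1 _).1 (h2 _).1, key _ _ (h1 _).1 (h2 _).2, key _ _ (h1 _).2 (h2 _).1⟩

/-- The integrand of `airyKernelIntegral` after the substitution `w = (3 s)^{-1/3}`. -/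
noncomputable def airyProduct (x t w : ℝ) : ℝ := 3 * t * (w * (airyAi (x * w) * airyAi (t * w)))

theorem exists_abs_airyProduct_le {t M : ℝ} (ht : 0 < t) (hM : 0 ≤ M) :
    ∃ C : ℝ, 0 ≤ C ∧ ∀ x : ℝ, |x| ≤ M → ∀ w : ℝ, 0 ≤ w →
      |airyProduct x t w| ≤ C * Real.exp (-1 * w) := by
  obtain ⟨C, hC, h⟩ := exists_abs_airyAi_mul_le ht hM
  refine ⟨3 * t * C, by positivity, fun x hx w hw => ?_⟩
  have h1 : w ≤ Real.exp w := by linarith [Real.add_one_le_exp w]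
  rw [airyProduct, abs_mul, abs_mul w, abs_of_nonneg hw, abs_of_pos (by positivity)]
  calc 3 * t * (w * |airyAi (x * w) * airyAi (t * w)|)
      ≤ 3 * t * (Real.exp w * (C * Real.exp (-2 * w))) := by
        gcongr
        exact (h x hx w hw).1
    _ = 3 * t * C * (Real.exp w * Real.exp (-2 * w)) := by ring
    _ = _ := by rw [← Real.exp_add]; congr 2; ring

theorem scaledAiry_mul_airyStableDensity (x t : ℝ) {s : ℝ} (hs : 0 < s) :
    scaledAiry x s * airyStableDensity s t =
      (1 / (3 * s) ^ (1 / 3 : ℝ)) ^ 4 * airyProduct x t (1 / (3 * s) ^ (1 / 3 : ℝ)) := by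
  rw [airyStableDensity_eq t hs, scaledAiry, airyProduct, mul_one_div x]
  ring

theorem integrableOn_airyProduct (x : ℝ) {t : ℝ} (ht : 0 < t) :
    IntegrableOn (airyProduct x t) (Set.Ioi 0) := by
  obtain ⟨C, -, h⟩ := exists_abs_airyProduct_le ht (abs_nonneg x)
  refine Integrable.mono' ((integrableOn_exp_neg_mul_Ioi one_pos).const_mul C)
    (Continuous.aestronglyMeasurable (by unfold airyProduct; fun_prop)) ?_
  filter_upwards [ae_restrict_mem measurableSet_Ioi] with w hw using h x le_rfl w (le_of_lt hw)

theorem integrableOn_airyKernel (x : ℝ) {t : ℝ} (ht : 0 < t) :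
    IntegrableOn (fun s => scaledAiry x s * airyStableDensity s t) (Set.Ioi 0) :=
  ((comp_inv_cubeRoot (airyProduct x t)).1.2 (integrableOn_airyProduct x ht)).congr_fun
    (fun _ hs => (scaledAiry_mul_airyStableDensity x t hs).symm) measurableSet_Ioi

theorem airyKernelIntegral_eq_integral_airyProduct (x t : ℝ) :
    airyKernelIntegral x t = ∫ w in Set.Ioi (0 : ℝ), airyProduct x t w := by
  rw [← (comp_inv_cubeRoot (airyProduct x t)).2]
  exact setIntegral_congr_fun measurableSet_Ioi fun s hs =>
    scaledAiry_mul_airyStableDensity x t hs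

theorem hasDerivAt_airyAi_mul (x w : ℝ) :
    HasDerivAt (fun w => airyAi (x * w)) (x * airyAiPrime (x * w)) w := by
  have := (hasDerivAt_airyAi (x * w)).comp w ((hasDerivAt_id w).const_mul x)
  exact this.congr_deriv (by ring)

theorem hasDerivAt_airyAiPrime_mul (x w : ℝ) :
    HasDerivAt (fun w => airyAiPrime (x * w)) (x ^ 2 * w * airyAi (x * w)) w := by
  have := (hasDerivAt_airyAiPrime (x * w)).comp w ((hasDerivAt_id w).const_mul x)
  exact this.congr_deriv (by ring)

theorem quadratic_form_pos (x : ℝ) {t : ℝ} (ht : 0 < t) : 0 < x ^ 2 + x * t + t ^ 2 := by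
  nlinarith [sq_nonneg (x + t / 2), sq_pos_of_pos ht]

/-- Ai(xw) and Ai(tw) solve y'' = x³w y and y'' = t³w y, so their Wronskian has derivative (t³ - x³)
w Ai(xw) Ai(tw). At w = 0 it equals (t - x) Ai(0) Ai'(0), and t - x cancels against t³ - x³. -/
theorem integral_airyProduct_of_ne {x t : ℝ} (ht : 0 < t) (hx : x ≠ t) :
    ∫ w in Set.Ioi (0 : ℝ), airyProduct x t w =
      √3 / (2 * π) * (t / (x ^ 2 + x * t + t ^ 2)) := by
  have hQ := quadratic_form_pos x ht
  have hsub : t - x ≠ 0 := sub_ne_zero.2 hx.symm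
  have hcube : t ^ 3 - x ^ 3 = (t - x) * (x ^ 2 + x * t + t ^ 2) := by ring
  obtain ⟨C, hC, h⟩ := exists_abs_airyAi_mul_le ht (abs_nonneg x)
  have hd : ∀ w : ℝ, HasDerivAt (fun w => 3 * t / (t ^ 3 - x ^ 3) *
      (t * (airyAi (x * w) * airyAiPrime (t * w)) - x * (airyAiPrime (x * w) * airyAi (t * w))))
      (airyProduct x t w) w := by
    intro w
    refine (((((hasDerivAt_airyAi_mul x w).mul (hasDerivAt_airyAiPrime_mul t w)).const_mul t).sub
      (((hasDerivAt_airyAiPrime_mul x w).mul (hasDerivAt_airyAi_mul t w)).const_mul x)).const_mul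
      (3 * t / (t ^ 3 - x ^ 3))).congr_deriv ?_
    rw [airyProduct, div_mul_eq_mul_div, div_eq_iff (hcube ▸ mul_ne_zero hsub hQ.ne')]
    ring
  have hlim : Tendsto (fun w => 3 * t / (t ^ 3 - x ^ 3) *
      (t * (airyAi (x * w) * airyAiPrime (t * w)) - x * (airyAiPrime (x * w) * airyAi (t * w))))
      atTop (𝓝 0) := by
    have h0 := tendsto_exp_neg_mul_atTop two_pos C
    have h1 : Tendsto (fun w => airyAi (x * w) * airyAiPrime (t * w)) atTop (𝓝 0) := by
      refine squeeze_zero_norm' ?_ h0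
      filter_upwards [eventually_ge_atTop 0] with w hw using (h x le_rfl w hw).2.1
    have h2 : Tendsto (fun w => airyAiPrime (x * w) * airyAi (t * w)) atTop (𝓝 0) := by
      refine squeeze_zero_norm' ?_ h0
      filter_upwards [eventually_ge_atTop 0] with w hw using (h x le_rfl w hw).2.2
    simpa using ((h1.const_mul t).sub (h2.const_mul x)).const_mul (3 * t / (t ^ 3 - x ^ 3))
  rw [integral_Ioi_of_hasDerivAt_of_tendsto' (fun w _ => hd w) (integrableOn_airyProduct x ht) hlim,
    mul_zero, mul_zero, mul_comm (airyAiPrime 0), airyAi_zero_mul_airyAiPrime_zero, hcube]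
  have := sqrt_three_sq
  have hpi := Real.pi_ne_zero
  field_simp
  rw [this]
  ring

/-- The Wronskian vanishes identically at x = t. Instead v²Ai² - vAi'² + Ai Ai' is a primitive of
3vAi², and at 0 it again equals Ai(0) Ai'(0). -/
theorem integral_airyProduct_self {t : ℝ} (ht : 0 < t) :
    ∫ w in Set.Ioi (0 : ℝ), airyProduct t t w =
      √3 / (2 * π) * (t / (t ^ 2 + t * t + t ^ 2)) := by
  obtain ⟨C, hC, h⟩ := exists_abs_airyAi_le 2 two_pos
  have hd : ∀ v : ℝ, HasDerivAt (fun v => v ^ 2 * airyAi v ^ 2 - v * airyAiPrime v ^ 2 +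
      airyAi v * airyAiPrime v) (3 * v * airyAi v ^ 2) v := by
    intro v
    have h1 := hasDerivAt_airyAi v
    have h2 := hasDerivAt_airyAiPrime v
    refine (((((hasDerivAt_id v).pow 2).mul (h1.pow 2)).sub
      ((hasDerivAt_id v).mul (h2.pow 2))).add (h1.mul h2)).congr_deriv ?_
    simp only [Pi.pow_apply, id]
    push_cast
    ring
  have hlim : Tendsto (fun v => v ^ 2 * airyAi v ^ 2 - v * airyAiPrime v ^ 2 +
      airyAi v * airyAiPrime v) atTop (𝓝 0) := by
    -- The 4 is 2 + 1 + 1, from v² ≤ 2eᵛ, v ≤ eᵛ and 1 ≤ eᵛ in the three terms.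
    refine squeeze_zero_norm' ?_ (tendsto_exp_neg_mul_atTop one_pos (4 * (C * C)))
    filter_upwards [eventually_ge_atTop 0] with v hv
    have e1 : v ≤ Real.exp v := by linarith [Real.add_one_le_exp v]
    have e0 : 1 ≤ Real.exp v := Real.one_le_exp hv
    set E := Real.exp v
    have e2 : v ^ 2 ≤ 2 * Real.exp v := by
      have := Real.quadratic_le_exp_of_nonneg hv
      linarith
    have key : ∀ a b : ℝ, |a| ≤ C * Real.exp (-2 * v) → |b| ≤ C * Real.exp (-2 * v) →
        |a * b| ≤ C * C * Real.exp (-2 * v) * Real.exp (-2 * v) := by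
      intro a b ha hb
      rw [abs_mul]
      refine (mul_le_mul ha hb (abs_nonneg _) (by positivity)).trans_eq (by ring)
    have k1 := key _ _ (h v).1 (h v).1
    have k2 := key _ _ (h v).2 (h v).2
    have k3 := key _ _ (h v).1 (h v).2
    set B := C * C * Real.exp (-2 * v) * Real.exp (-2 * v) with hB
    have hB0 : 0 ≤ B := by positivity
    have hEB : 4 * (E * B) ≤ 4 * (C * C) * Real.exp (-1 * v) := by
      have : E * B = C * C * Real.exp (-3 * v) := by
        have e3 : E * Real.exp (-2 * v) * Real.exp (-2 * v) = Real.exp (-3 * v) := by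
          rw [← Real.exp_add, ← Real.exp_add]; congr 1; ring
        rw [← e3, hB]; ring
      rw [this, ← mul_assoc]
      refine mul_le_mul_of_nonneg_left (Real.exp_le_exp.2 (by linarith)) (by positivity)
    refine le_trans ?_ hEB
    rw [Real.norm_eq_abs]
    have t1 : |v ^ 2 * airyAi v ^ 2| ≤ 2 * (E * B) := by
      rw [abs_mul, abs_of_nonneg (by positivity), pow_two (airyAi v)]
      exact (mul_le_mul e2 k1 (abs_nonneg _) (by positivity)).trans_eq (by ring)
    have t2 : |v * airyAiPrime v ^ 2| ≤ E * B := by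
      rw [abs_mul, abs_of_nonneg hv, pow_two (airyAiPrime v)]
      exact mul_le_mul e1 k2 (abs_nonneg _) (by positivity)
    have t3 : |airyAi v * airyAiPrime v| ≤ E * B :=
      k3.trans (le_mul_of_one_le_left hB0 e0)
    have s1 := abs_add_le (v ^ 2 * airyAi v ^ 2 - v * airyAiPrime v ^ 2)
      (airyAi v * airyAiPrime v)
    have s2 := abs_sub (v ^ 2 * airyAi v ^ 2) (v * airyAiPrime v ^ 2)
    linarith
  have hd2 : ∀ w : ℝ, HasDerivAt (fun w => 1 / t * ((t * w) ^ 2 * airyAi (t * w) ^ 2 -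
      (t * w) * airyAiPrime (t * w) ^ 2 + airyAi (t * w) * airyAiPrime (t * w)))
      (airyProduct t t w) w := by
    intro w
    refine (((hd (t * w)).comp w ((hasDerivAt_id w).const_mul t)).const_mul
      (1 / t)).congr_deriv ?_
    rw [airyProduct]
    field_simp
  have hlim2 := (hlim.comp (tendsto_id.const_mul_atTop ht)).const_mul (1 / t)
  rw [mul_zero] at hlim2
  rw [integral_Ioi_of_hasDerivAt_of_tendsto' (fun w _ => hd2 w) (integrableOn_airyProduct t ht)
    hlim2, mul_zero, airyAi_zero_mul_airyAiPrime_zero]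
  have := sqrt_three_sq
  have hpi := Real.pi_ne_zero
  field_simp
  linear_combination -this

theorem airyKernelIntegral_eq (x : ℝ) {t : ℝ} (ht : 0 < t) :
    airyKernelIntegral x t = √3 / (2 * π) * (t / (x ^ 2 + x * t + t ^ 2)) := by
  rw [airyKernelIntegral_eq_integral_airyProduct]
  rcases eq_or_ne x t with rfl | hx
  · exact integral_airyProduct_self ht
  · exact integral_airyProduct_of_ne ht hx

theorem airyKernelIntegral_eq_cauchy (x : ℝ) {t : ℝ} (ht : 0 < t) :
    airyKernelIntegral x t = 1 / π * (√3 / 2 * t / ((x + t / 2) ^ 2 + 3 * t ^ 2 / 4)) := by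
  have h : (x + t / 2) ^ 2 + 3 * t ^ 2 / 4 = x ^ 2 + x * t + t ^ 2 := by ring
  rw [airyKernelIntegral_eq x ht, h]
  ring

theorem airyKernelIntegral_eq_cubic {x t : ℝ} (ht : 0 < t) (hx : x ≠ t) :
    airyKernelIntegral x t = √3 * t / (2 * π) * ((x - t) / (x ^ 3 - t ^ 3)) := by
  have hQ := quadratic_form_pos x ht
  have hsub : x - t ≠ 0 := sub_ne_zero.2 hx
  have hcube : x ^ 3 - t ^ 3 = (x - t) * (x ^ 2 + x * t + t ^ 2) := by ring
  rw [airyKernelIntegral_eq x ht, hcube, div_mul_cancel_left₀ hsub]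
  ring

/-! ### Smoothness and the third-order Laplace equation. -/

theorem contDiffOn_airyKernelIntegral :
    ContDiffOn ℝ (⊤ : ℕ∞) (fun p : ℝ × ℝ => airyKernelIntegral p.1 p.2) {p : ℝ × ℝ | 0 < p.2} := by
  have h : ContDiffOn ℝ (⊤ : ℕ∞) (fun p : ℝ × ℝ =>
      √3 / (2 * π) * (p.2 / (p.1 ^ 2 + p.1 * p.2 + p.2 ^ 2))) {p : ℝ × ℝ | 0 < p.2} := by
    refine contDiffOn_const.mul (ContDiffOn.div (by fun_prop) (by fun_prop) ?_)
    exact fun p hp => (quadratic_form_pos p.1 hp).ne'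
  exact h.congr fun p hp => airyKernelIntegral_eq p.1 hp

/-- The hypotheses are local because the closed form in the time variable is available only for
positive times. -/
theorem iteratedDeriv_three_eq {f f₁ f₂ : ℝ → ℝ} {f₃ x : ℝ}
    (h₀ : ∀ᶠ y in 𝓝 x, HasDerivAt f (f₁ y) y) (h₁ : ∀ᶠ y in 𝓝 x, HasDerivAt f₁ (f₂ y) y)
    (h₂ : HasDerivAt f₂ f₃ x) : iteratedDeriv 3 f x = f₃ := by
  have e1 : deriv f =ᶠ[𝓝 x] f₁ := h₀.mono fun y hy => hy.deriv
  have e2 : deriv f₁ =ᶠ[𝓝 x] f₂ := h₁.mono fun y hy => hy.deriv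
  rw [iteratedDeriv_succ, iteratedDeriv_succ, iteratedDeriv_one]
  rw [((e1.deriv).trans e2).deriv_eq, h₂.deriv]

/-- The closed form is (1/π) Im 1/(x - ωt) with ω = exp(2πi/3). As ω³ = 1, any f(x - ωt) has
opposite third derivatives in x and t; here and in `iteratedDeriv_three_time` this is checked by
explicit quotients. -/
theorem iteratedDeriv_three_space (x : ℝ) {t : ℝ} (ht : 0 < t) :
    iteratedDeriv 3 (fun y : ℝ => airyKernelIntegral y t) x =
      √3 / (2 * π) * (6 * t * (2 * x + t) * (t ^ 2 - 2 * x ^ 2 - 2 * x * t) /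
        (x ^ 2 + x * t + t ^ 2) ^ 4) := by
  have hQ : ∀ y, HasDerivAt (fun y : ℝ => y ^ 2 + y * t + t ^ 2) (2 * y + t) y := by
    intro y
    refine ((((hasDerivAt_id y).pow 2).add ((hasDerivAt_id y).mul_const t)).add_const
      (t ^ 2)).congr_deriv ?_
    simp
  have hne : ∀ y : ℝ, y ^ 2 + y * t + t ^ 2 ≠ 0 := fun y => (quadratic_form_pos y ht).ne'
  rw [funext fun y => airyKernelIntegral_eq y ht]
  refine iteratedDeriv_three_eq
    (f₁ := fun y => √3 / (2 * π) * (-t * (2 * y + t) / (y ^ 2 + y * t + t ^ 2) ^ 2))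
    (f₂ := fun y => √3 / (2 * π) * (6 * t * (y ^ 2 + y * t) / (y ^ 2 + y * t + t ^ 2) ^ 3))
    (Eventually.of_forall fun y => ?_) (Eventually.of_forall fun y => ?_) ?_
  · refine (((hasDerivAt_const y t).div (hQ y) (hne y)).const_mul _).congr_deriv ?_
    simp
  · have hN : HasDerivAt (fun y : ℝ => -t * (2 * y + t)) (-t * 2) y := by
      refine ((((hasDerivAt_id y).const_mul 2).add_const t).const_mul (-t)).congr_deriv (by simp)
    refine ((hN.div ((hQ y).pow 2) (pow_ne_zero 2 (hne y))).const_mul _).congr_deriv ?_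
    have := hne y
    simp only [Pi.pow_apply]
    congr 1
    rw [div_eq_div_iff (pow_ne_zero _ (pow_ne_zero _ this)) (pow_ne_zero _ this)]
    push_cast
    ring
  · have hN : HasDerivAt (fun y : ℝ => 6 * t * (y ^ 2 + y * t)) (6 * t * (2 * x + t)) x := by
      refine ((((hasDerivAt_id x).pow 2).add ((hasDerivAt_id x).mul_const t)).const_mul
        (6 * t)).congr_deriv (by simp)
    refine ((hN.div ((hQ x).pow 3) (pow_ne_zero 3 (hne x))).const_mul _).congr_deriv ?_
    have := hne x
    simp only [Pi.pow_apply]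
    congr 1
    rw [div_eq_div_iff (pow_ne_zero _ (pow_ne_zero _ this)) (pow_ne_zero _ this)]
    push_cast
    ring

theorem iteratedDeriv_three_time (x : ℝ) {t : ℝ} (ht : 0 < t) :
    iteratedDeriv 3 (fun τ : ℝ => airyKernelIntegral x τ) t =
      -(√3 / (2 * π) * (6 * t * (2 * x + t) * (t ^ 2 - 2 * x ^ 2 - 2 * x * t) /
        (x ^ 2 + x * t + t ^ 2) ^ 4)) := by
  have hQ : ∀ τ, HasDerivAt (fun τ : ℝ => x ^ 2 + x * τ + τ ^ 2) (x + 2 * τ) τ := by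
    intro τ
    refine ((((hasDerivAt_id τ).const_mul x).const_add (x ^ 2)).add
      ((hasDerivAt_id τ).pow 2)).congr_deriv ?_
    simp
  have hne : ∀ τ : ℝ, 0 < τ → x ^ 2 + x * τ + τ ^ 2 ≠ 0 := fun τ hτ =>
    (quadratic_form_pos x hτ).ne'
  have hev : (fun τ : ℝ => airyKernelIntegral x τ) =ᶠ[𝓝 t]
      fun τ => √3 / (2 * π) * (τ / (x ^ 2 + x * τ + τ ^ 2)) := by
    filter_upwards [eventually_gt_nhds ht] with τ hτ using airyKernelIntegral_eq x hτ
  rw [hev.iteratedDeriv_eq]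
  refine iteratedDeriv_three_eq
    (f₁ := fun τ => √3 / (2 * π) * ((x ^ 2 - τ ^ 2) / (x ^ 2 + x * τ + τ ^ 2) ^ 2))
    (f₂ := fun τ => √3 / (2 * π) * ((2 * τ ^ 3 - 6 * x ^ 2 * τ - 2 * x ^ 3) /
      (x ^ 2 + x * τ + τ ^ 2) ^ 3)) ?_ ?_ ?_
  · filter_upwards [eventually_gt_nhds ht] with τ hτ
    refine (((hasDerivAt_id τ).div (hQ τ) (hne τ hτ)).const_mul _).congr_deriv ?_
    simp only [id]
    congr 2
    ring
  · filter_upwards [eventually_gt_nhds ht] with τ hτ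
    have hN : HasDerivAt (fun τ : ℝ => x ^ 2 - τ ^ 2) (-(2 * τ)) τ := by
      refine (((hasDerivAt_id τ).pow 2).const_sub (x ^ 2)).congr_deriv (by simp)
    refine ((hN.div ((hQ τ).pow 2) (pow_ne_zero 2 (hne τ hτ))).const_mul _).congr_deriv ?_
    have := hne τ hτ
    simp only [Pi.pow_apply]
    congr 1
    rw [div_eq_div_iff (pow_ne_zero _ (pow_ne_zero _ this)) (pow_ne_zero _ this)]
    push_cast
    ring
  · have hN : HasDerivAt (fun τ : ℝ => 2 * τ ^ 3 - 6 * x ^ 2 * τ - 2 * x ^ 3)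
        (6 * t ^ 2 - 6 * x ^ 2) t := by
      refine (((((hasDerivAt_id t).pow 3).const_mul 2).sub
        ((hasDerivAt_id t).const_mul (6 * x ^ 2))).sub_const (2 * x ^ 3)).congr_deriv ?_
      simp
      ring
    refine ((hN.div ((hQ t).pow 3) (pow_ne_zero 3 (hne t ht))).const_mul _).congr_deriv ?_
    have := hne t ht
    rw [← mul_neg, ← neg_div]
    simp only [Pi.pow_apply]
    congr 1
    rw [div_eq_div_iff (pow_ne_zero _ (pow_ne_zero _ this)) (pow_ne_zero _ this)]
    push_cast
    ring

/-! ### The law of the composition. -/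

theorem measurable_scaledAiry : Measurable fun p : ℝ × ℝ => scaledAiry p.1 p.2 := by
  have h : Measurable fun p : ℝ × ℝ => (3 * p.2) ^ (1 / 3 : ℝ) := by fun_prop
  unfold scaledAiry
  exact (measurable_const.div h).mul (continuous_airyAi.measurable.comp (measurable_fst.div h))

theorem measurable_airyStableDensity (t : ℝ) : Measurable fun s : ℝ => airyStableDensity s t := by
  unfold airyStableDensity
  exact (measurable_const.div measurable_id).mul
    (measurable_scaledAiry.comp (measurable_const.prodMk measurable_id))

/-- The kernel `scaledAiry x s * airyStableDensity s t` is integrable in both variables over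
`(a, b] × (0, ∞)`. -/
theorem integrable_airyKernel_prod {t : ℝ} (ht : 0 < t) (a b : ℝ) :
    Integrable (fun p : ℝ × ℝ => scaledAiry p.1 p.2 * airyStableDensity p.2 t)
      ((volume.restrict (Set.Ioc a b)).prod (volume.restrict (Set.Ioi 0))) := by
  obtain ⟨C, hC, h⟩ := exists_abs_airyProduct_le (M := max |a| |b|) ht
    (le_max_of_le_left (abs_nonneg a))
  have h1 : IntegrableOn (fun s : ℝ => (1 / (3 * s) ^ (1 / 3 : ℝ)) ^ 4 *
      (C * Real.exp (-1 * (1 / (3 * s) ^ (1 / 3 : ℝ))))) (Set.Ioi 0) :=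
    (comp_inv_cubeRoot fun w => C * Real.exp (-1 * w)).1.2
      ((integrableOn_exp_neg_mul_Ioi one_pos).const_mul C)
  -- The dominating function depends on s alone, and the x-interval has finite measure.
  refine Integrable.mono' (Integrable.comp_snd h1 (volume.restrict (Set.Ioc a b)))
    (measurable_scaledAiry.mul
      ((measurable_airyStableDensity t).comp measurable_snd)).aestronglyMeasurable ?_
  rw [Measure.prod_restrict]
  filter_upwards [ae_restrict_mem (measurableSet_Ioc.prod measurableSet_Ioi)] with p hp
  have hs : 0 < p.2 := hp.2
  rw [scaledAiry_mul_airyStableDensity _ t hs, norm_mul, Real.norm_of_nonneg (by positivity)]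
  refine mul_le_mul_of_nonneg_left (h p.1 ?_ _ (by positivity)) (by positivity)
  exact abs_le_max_abs_abs hp.1.1.le hp.1.2

theorem pseudoMarginal3_eq {s a b : ℝ} (hs : 0 < s) (hab : a ≤ b) :
    pseudoMarginal3 s a b = ∫ x in Set.Ioc a b, scaledAiry x s := by
  simp only [pseudoMarginal3, pseudoCylinder3, sub_zero, mul_one]
  rw [intervalIntegral.integral_of_le hab]
  simp only [heatKernel3_eq_scaledAiry _ hs]

theorem airyStableDensity_mul_pseudoMarginal3 {s a b : ℝ} (t : ℝ) (hs : 0 < s) (hab : a ≤ b) :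
    airyStableDensity s t * pseudoMarginal3 s a b =
      ∫ x in Set.Ioc a b, scaledAiry x s * airyStableDensity s t := by
  rw [pseudoMarginal3_eq hs hab, integral_mul_const, mul_comm]

theorem integrable_pseudoMarginal3 {t a b : ℝ} (ht : 0 < t) (hab : a ≤ b) :
    Integrable (fun s => pseudoMarginal3 s a b) (airyStableMeasure t) := by
  rw [integrable_airyStableMeasure ht]
  have h : IntegrableOn (fun s => ∫ x in Set.Ioc a b, scaledAiry x s * airyStableDensity s t)
      (Set.Ioi 0) := (integrable_airyKernel_prod ht a b).integral_prod_right
  exact h.congr_fun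
    (fun s hs => (airyStableDensity_mul_pseudoMarginal3 t hs hab).symm) measurableSet_Ioi

/-- Fubini: averaging over s and integrating over x commute by `integrable_airyKernel_prod`. -/
theorem integral_pseudoMarginal3 {t a b : ℝ} (ht : 0 < t) (hab : a ≤ b) :
    ∫ s, pseudoMarginal3 s a b ∂airyStableMeasure t = ∫ x in a..b, airyKernelIntegral x t := by
  rw [integral_airyStableMeasure ht]
  simp only [smul_eq_mul]
  rw [setIntegral_congr_fun measurableSet_Ioi
    (fun s hs => airyStableDensity_mul_pseudoMarginal3 t hs hab),
    intervalIntegral.integral_of_le hab]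
  exact (integral_integral_swap (integrable_airyKernel_prod ht a b)).symm

theorem composedLaw3_eq {Ω : Type*} [MeasurableSpace Ω] {P : Measure Ω}
    {S : ℝ → Ω → ℝ} (hS : HasStableMarginals (1 / 3) P S) {t a b : ℝ} (ht : 0 < t) (hab : a ≤ b) :
    Integrable (fun ω => pseudoMarginal3 (S t ω) a b) P ∧
      composedLaw3 P S t a b = ∫ x in a..b, airyKernelIntegral x t := by
  obtain ⟨hm, hlaw⟩ := hS t ht
  -- Uniqueness of the stable law replaces the unknown distribution of S(t) by the explicit Airy
  -- measure.
  rw [isStableLaw_third_iff ht] at hlaw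
  have hi := integrable_pseudoMarginal3 ht hab
  rw [← hlaw] at hi
  refine ⟨hi.comp_aemeasurable hm, ?_⟩
  rw [← integral_pseudoMarginal3 ht hab, ← hlaw, integral_map hm hi.aestronglyMeasurable]
  rfl

theorem mainTheorem3 :
    -- the fundamental solution in its Fourier and Airy forms; the improper integrals converge
    (∀ x s : ℝ, 0 < s →
      Tendsto (fun R : ℝ => (1 / (2 * π) : ℂ) * ∫ β in (-R)..R,
          Complex.exp (-Complex.I * ((β * x : ℝ) : ℂ) - Complex.I * ((s * β ^ 3 : ℝ) : ℂ)))
        atTop (𝓝 (heatKernel3 x s : ℂ)) ∧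
      heatKernel3 x s = scaledAiry x s) ∧
    -- the positively skewed stable law of order 1/3 and its density
    (∀ t : ℝ, 0 < t →
      (∀ s : ℝ, 0 < s → 0 ≤ airyStableDensity s t) ∧
      (∀ ν : Measure ℝ, IsStableLaw (1 / 3) (1 / 3) t ν ↔ ν = airyStableMeasure t) ∧
      (∀ s : ℝ, 0 < s → stableDensity (1 / 3) (1 / 3) s t = (airyStableDensity s t : ℂ))) ∧
    -- the law of the composition has the Airy-kernel integral as its density
    (∀ (Ω : Type*) [MeasurableSpace Ω] (P : Measure Ω) [IsProbabilityMeasure P]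
        (S : ℝ → Ω → ℝ), HasStableMarginals (1 / 3) P S →
      ∀ t a b : ℝ, 0 < t → a ≤ b →
        Integrable (fun ω => pseudoMarginal3 (S t ω) a b) P ∧
        composedLaw3 P S t a b = ∫ x in a..b, airyKernelIntegral x t) ∧
    -- the Airy-kernel integral is a Cauchy density
    (∀ x t : ℝ, 0 < t →
      IntegrableOn (fun s => scaledAiry x s * airyStableDensity s t) (Set.Ioi 0) ∧
      airyKernelIntegral x t = 1 / π * (√3 / 2 * t / ((x + t / 2) ^ 2 + 3 * t ^ 2 / 4)) ∧
      airyKernelIntegral x t = √3 / (2 * π) * (t / (x ^ 2 + x * t + t ^ 2)) ∧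
      (x ≠ t → airyKernelIntegral x t = √3 * t / (2 * π) * ((x - t) / (x ^ 3 - t ^ 3)))) ∧
    -- it is smooth and solves the third-order Laplace equation
    ContDiffOn ℝ (⊤ : ℕ∞) (fun p : ℝ × ℝ => airyKernelIntegral p.1 p.2) {p : ℝ × ℝ | 0 < p.2} ∧
    (∀ x t : ℝ, 0 < t →
      iteratedDeriv 3 (fun τ : ℝ => airyKernelIntegral x τ) t +
        iteratedDeriv 3 (fun y : ℝ => airyKernelIntegral y t) x = 0) := by
  refine ⟨fun x s hs => ⟨tendsto_fourier_heatKernel3 x hs, heatKernel3_eq_scaledAiry x hs⟩,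
    fun t ht => ⟨fun s hs => airyStableDensity_nonneg hs ht, isStableLaw_third_iff ht,
      fun s hs => stableDensity_third_of_pos hs ht⟩,
    fun Ω _ P _ S hS t a b ht hab => composedLaw3_eq hS ht hab,
    fun x t ht => ⟨integrableOn_airyKernel x ht, airyKernelIntegral_eq_cauchy x ht,
      airyKernelIntegral_eq x ht, airyKernelIntegral_eq_cubic ht⟩,
    contDiffOn_airyKernelIntegral, fun x t ht => ?_⟩
  rw [iteratedDeriv_three_time x ht, iteratedDeriv_three_space x ht, neg_add_cancel]
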